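/- Let $K$ be a field and let $\mathsf{Hopf}_{K,coc}$ be the category of cocommutative Hopf algebras over $K$ and Hopf algebra morphisms. Write $\Delta(a)=a_1\otimes a_2$, and let $\epsilon$, $S$ denote counits and antipodes. *Hopf crossed modules.* For $B, X$ in $\mathsf{Hopf}_{K,coc}$, a $B$-module Hopf algebra structure on $X$ is a $K$-linear map $B\otimes X\to X$, $b\otimes x\mapsto {}^b x$, such that $$ {}^{bb'}x={}^b({}^{b'}x),\quad {}^1x=x,\quad {}^b(xy)=({}^{b_1}x)({}^{b_2}y),\quad {}^b1=\epsilon(b)1,\quad \Delta({}^bx)={}^{b_1}x_1\otimes{}^{b_2}x_2,\quad \epsilon({}^bx)=\epsilon(b)\epsilon(x). $$ A Hopf crossed module is a morphism $d\colon X\to B$ in $\mathsf{Hopf}_{K,coc}$ together with a $B$-module Hopf algebra structure on $X$ such that, for all $b\in B$ and $x,y\in X$, $$ d({}^bx)=b_1\,d(x)\,S(b_2),\qquad {}^{d(y)}x=y_1\,x\,S(y_2). $$ A morphism $(B,X,d)\to(B',X',d')$ is a pair of Hopf algebra morphisms $\beta\colon B\to B'$, $\alpha\colon X\to X'$ with $d'\alpha=\beta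 d$ and $\alpha({}^bx)={}^{\beta(b)}\alpha(x)$. This defines the category $\mathsf{HXMod}_{K,coc}$. *Internal groupoids.* An internal groupoid in $\mathsf{Hopf}_{K,coc}$ is a reflexive graph $\delta,\gamma\colon A_1\rightrightarrows A_0$, $i\colon A_0\to A_1$, $\delta i=1=\gamma i$, with a pullback $P=A_1\times_{A_0}A_1$ of $\delta$ (first factor) and $\gamma$ (second factor), with projections $\pi_1,\pi_2\colon P\to A_1$, and a multiplication $m\colon P\to A_1$ that is associative and satisfies $m(1,i\delta)=1=m(i\gamma,1)$, $\delta m=\delta \pi_2$, $\gamma m=\gamma \pi_1$, and for which an inversion $A_1\to A_1$ exists. Morphisms are morphisms of reflexive graphs $(f_0,f_1)$ that preserve $m$. This defines the category $\mathsf{Grpd}(\mathsf{Hopf}_{K,coc})$. **Proposition.** The categories $\mathsf{Grpd}(\mathsf{Hopf}_{K,coc})$ and $\mathsf{HXMod}_{K,coc}$ are equivalent. More precisely, there is an equivalence with the following two properties. 1. Up to natural isomorphism, it sends a groupoid $(A_1,A_0,\delta,\gamma,i,m)$ to $$ d=\gamma\cdot hker(\delta)\colon HKer(\delta)\to A_0,\qquad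 {}^ak=i(a_1)\,k\,i(S(a_2)), $$ where $HKer(\delta)=\{a\in A_1 : \delta(a_1)\otimes a_2=1\otimes a\}$ with inclusion $hker(\delta)$ into $A_1$, and it sends an internal functor $(f_0,f_1)$ to $f_0$ together with the restriction of $f_1$ to $HKer(\delta)$. 2. Up to natural isomorphism, its quasi-inverse sends a Hopf crossed module $d\colon X\to B$ to the groupoid whose underlying reflexive graph is $X\rtimes B\rightrightarrows B$ with $$ \delta=p_2,\ p_2(x\otimes b)=\epsilon(x)b,\qquad \gamma=p_1,\ p_1(x\otimes b)=d(x)b,\qquad i=e,\ e(b)=1\otimes b, $$ and it sends $(\beta,\alpha)$ to $(\beta,\alpha\otimes\beta)$. Here $X\rtimes B$ is the smash product: the coalgebra $X\otimes B$ (tensor product coalgebra) with unit $1\otimes 1$ and product $(x\otimes b)(x'\otimes b')=x\,({}^{b_1}x')\otimes b_2b'$. Under these isomorphisms the groupoid multiplication is the restriction to the pullback of $$ m(x\otimes b,\ x'\otimes b')=xx'\otimes\epsilon(b)b'. $$ -/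

import Mathlib

universe u v w

open CategoryTheory TensorProduct Coalgebra Bialgebra HopfAlgebra WithConv

namespace HopfXMod

section Basics

variable {K : Type u} [Field K] {A B : Type v} [Ring A] [HopfAlgebra K A]
  [Ring B] [HopfAlgebra K B]
  {C : Type w} [AddCommGroup C] [Module K C] [Coalgebra K C]

/-- The antipode is a convolution inverse along every coalgebra morphism. -/
theorem antipode_conv_left (g : C →ₗc[K] A) :
    toConv (antipode K ∘ₗ g.toLinearMap) * toConv g.toLinearMap = 1 := by
  have h := LinearMap.convMul_comp_coalgHom_distrib
    (toConv (antipode K (A := A))) (toConv LinearMap.id) g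
  rw [LinearMap.antipode_mul_id] at h
  apply WithConv.ofConv_injective
  rw [LinearMap.convOne_def] at h ⊢
  simpa [LinearMap.comp_assoc] using h.symm

theorem antipode_conv_right (g : C →ₗc[K] A) :
    toConv g.toLinearMap * toConv (antipode K ∘ₗ g.toLinearMap) = 1 := by
  have h := LinearMap.convMul_comp_coalgHom_distrib
    (toConv LinearMap.id) (toConv (antipode K (A := A))) g
  rw [LinearMap.id_mul_antipode] at h
  apply WithConv.ofConv_injective
  rw [LinearMap.convOne_def] at h ⊢
  simpa [LinearMap.comp_assoc] using h.symm

/-- Morphisms of bialgebras between Hopf algebras preserve the antipode. -/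
theorem map_antipode (f : A →ₐc[K] B) (a : A) : f (antipode K a) = antipode K (f a) := by
  have h := LinearMap.algHom_comp_convMul_distrib (f : A →ₐ[K] B)
    (toConv LinearMap.id) (toConv (antipode K (A := A)))
  rw [LinearMap.id_mul_antipode] at h
  have h1 : toConv ((f : A →ₗc[K] B).toLinearMap) *
      toConv ((f : A →ₐ[K] B).toLinearMap ∘ₗ antipode K) = 1 := by
    apply WithConv.ofConv_injective
    rw [LinearMap.convOne_def] at h ⊢
    refine h.symm.trans ?_
    ext x
    exact (f : A →ₐ[K] B).commutes (counit x)
  have h2 := left_inv_eq_right_inv (antipode_conv_left (f : A →ₗc[K] B)) h1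
  exact (LinearMap.congr_fun (WithConv.toConv_injective h2) a).symm

variable (K) in
/-- The adjoint action of a Hopf algebra on itself, `ad a x = a₁ x S(a₂)`. -/
noncomputable def ad : A →ₐ[K] Module.End K A :=
  (AlgHom.mulLeftRight K A).comp
    ((Algebra.TensorProduct.map (AlgHom.id K A) (antipodeAlgHomOp K A)).comp (comulAlgHom K A))

theorem ad_repr {ι : Type*} {a : A} (r : Coalgebra.Repr K a ι) (x : A) :
    ad K a x = ∑ i ∈ r.index, r.left i * x * antipode K (r.right i) := by
  simp [ad, ← r.eq]

theorem ad_map (f : A →ₐc[K] B) (a x : A) : f (ad K a x) = ad K (f a) (f x) := by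
  rw [ad_repr (ℛ K a), ad_repr ((ℛ K a).induced f)]
  simp [map_antipode]

theorem ad_tmul (u p : A) (v q : B) :
    ad K (u ⊗ₜ[K] v) (p ⊗ₜ[K] q) = ad K u p ⊗ₜ[K] ad K v q := by
  rw [ad_repr ((ℛ K u).tmul (ℛ K v)), ad_repr (ℛ K u), ad_repr (ℛ K v)]
  simp [TensorProduct.sum_tmul, TensorProduct.tmul_sum, Finset.sum_product]
  exact Finset.sum_comm

theorem ad_one (a : A) : ad K a 1 = algebraMap K A (counit a) := by
  rw [ad_repr (ℛ K a)]
  simp [sum_mul_antipode_eq_algebraMap_counit]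

theorem counit_ad (a x : A) : counit (R := K) (ad K a x) = counit (R := K) a * counit (R := K) x := by
  rw [ad_repr (ℛ K a)]
  simp only [map_sum, counit_mul, counit_antipode]
  conv_rhs => rw [← sum_counit_smul (ℛ K a)]
  simp [Finset.sum_mul]
  exact Finset.sum_congr rfl fun _ _ => by ring

theorem ad_mul {ι : Type*} {a : A} (r : Coalgebra.Repr K a ι) (x y : A) :
    ad K a (x * y) = ∑ i ∈ r.index, ad K (r.left i) x * ad K (r.right i) y := by
  let c : A → WithConv (A →ₗ[K] A) := fun x => toConv ((counit (R := K) (A := A)).smulRight x)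
  let I : WithConv (A →ₗ[K] A) := toConv LinearMap.id
  let S : WithConv (A →ₗ[K] A) := toConv (antipode K)
  have hI : ∀ x, I * c x = toConv (LinearMap.mulRight K x) := by
    intro x
    ext a
    have h : (I * 1 : WithConv (A →ₗ[K] A)) a = a := by rw [mul_one]; rfl
    rw [(ℛ K a).convMul_apply] at h ⊢
    conv_rhs => rw [← h]
    simp [I, c, Algebra.algebraMap_eq_smul_one]
  have hT : ∀ x, toConv ((ad K).toLinearMap.flip x) = I * c x * S := by
    intro x
    rw [hI]
    ext a
    rw [(ℛ K a).convMul_apply]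
    simp [ad_repr (ℛ K a), S]
  have hc : c x * c y = c (x * y) := by
    ext a
    have h := congr($(sum_counit_smul (ℛ K a)))
    rw [(ℛ K a).convMul_apply]
    conv_rhs => rw [← h]
    simp [c, smul_smul, mul_comm]
  have hSI : S * I = 1 := LinearMap.antipode_mul_id
  have key : toConv ((ad K).toLinearMap.flip (x * y)) =
      toConv ((ad K).toLinearMap.flip x) * toConv ((ad K).toLinearMap.flip y) := by
    rw [hT, hT, hT, ← hc]
    calc I * (c x * c y) * S = I * c x * 1 * c y * S := by simp [mul_assoc]
      _ = _ := by rw [← hSI]; simp only [mul_assoc]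
  have := congr($key a)
  rw [r.convMul_apply] at this
  exact this

theorem comul_ad [IsCocomm K A] (a x : A) :
    comul (R := K) (ad K a x) =
      TensorProduct.map₂ (ad K).toLinearMap (ad K).toLinearMap (comul a) (comul x) := by
  have h := ad_map (comulBialgHom K A) a x
  refine h.trans ?_
  change ad K (comul a) (comul x) = _
  generalize comul (R := K) a = u
  generalize comul (R := K) x = v
  induction u with
  | zero => simp
  | add u u' h h' => simp [h, h']
  | tmul u u' =>
    induction v with
    | zero => simp
    | add v v' h h' => simp [h, h']
    | tmul v v' => simp [ad_tmul]


/-- The map `a ↦ f(a₁) ⊗ a₂`. -/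
noncomputable def coact (f : A →ₐc[K] B) : A →ₐ[K] B ⊗[K] A :=
  (Algebra.TensorProduct.map (f : A →ₐ[K] B) (AlgHom.id K A)).comp (comulAlgHom K A)

/-- The Hopf kernel `HKer f = {a | f(a₁) ⊗ a₂ = 1 ⊗ a}`. -/
noncomputable def HKer (f : A →ₐc[K] B) : Subalgebra K A :=
  AlgHom.equalizer (coact f) Algebra.TensorProduct.includeRight

theorem mem_HKer (f : A →ₐc[K] B) (a : A) :
    a ∈ HKer f ↔ TensorProduct.map (f : A →ₗ[K] B) LinearMap.id (comul (R := K) a) = 1 ⊗ₜ[K] a :=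
  Iff.rfl

theorem antipode_mem_HKer [IsCocomm K A] (f : A →ₐc[K] B) {a : A} (ha : a ∈ HKer f) :
    antipode K a ∈ HKer f := by
  rw [mem_HKer] at ha ⊢
  let F : A →ₐc[K] B ⊗[K] A :=
    (Bialgebra.TensorProduct.map f (BialgHom.id K A)).comp (comulBialgHom K A)
  have h := map_antipode F a
  change F a = _ at ha
  change F (antipode K a) = _
  rw [h, ha]
  simp [TensorProduct.antipode_def]

theorem ad_mem_HKer [IsCocomm K A] (f : A →ₐc[K] B) (a : A) {x : A} (hx : x ∈ HKer f) :
    ad K a x ∈ HKer f := by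
  rw [mem_HKer] at hx ⊢
  let F : A →ₐc[K] B ⊗[K] A :=
    (Bialgebra.TensorProduct.map f (BialgHom.id K A)).comp (comulBialgHom K A)
  have h := ad_map F a x
  change F x = _ at hx
  change F (ad K a x) = _
  have hF : F a = TensorProduct.map (f : A →ₗ[K] B) LinearMap.id (comul (R := K) a) := rfl
  rw [h, hx, hF]
  have e := sum_counit_smul (ℛ K a)
  rw [← (ℛ K a).eq]
  simp only [map_sum, TensorProduct.map_tmul, LinearMap.sum_apply, ad_tmul, ad_one]
  conv_rhs => rw [← e]
  simp [TensorProduct.tmul_sum, Algebra.algebraMap_eq_smul_one, TensorProduct.smul_tmul]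

/-- Over a field, `(ker p ⊗ A) ∩ (A ⊗ ker p) = ker p ⊗ ker p`. -/
theorem mem_range_map_subtype {V W : Type*} [AddCommGroup V] [Module K V] [AddCommGroup W]
    [Module K W] (p : V →ₗ[K] W) (N : Submodule K V) (hN : N = LinearMap.ker p) (w : V ⊗[K] V)
    (h1 : p.rTensor V w = 0) (h2 : p.lTensor V w = 0) :
    w ∈ LinearMap.range (TensorProduct.map N.subtype N.subtype) := by
  have ex : Function.Exact N.subtype p := by
    rw [LinearMap.exact_iff, hN]; simp
  obtain ⟨u, rfl⟩ := (Module.Flat.rTensor_exact V ex w).1 h1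
  have h3 : N.subtype.rTensor W (p.lTensor N u) = 0 := by
    rw [← h2, ← LinearMap.comp_apply, ← LinearMap.comp_apply, LinearMap.rTensor_comp_lTensor,
      LinearMap.lTensor_comp_rTensor]
  have h4 : p.lTensor N u = 0 :=
    (map_eq_zero_iff _ (Module.Flat.rTensor_preserves_injective_linearMap (M := W) N.subtype
      N.injective_subtype)).1 h3
  obtain ⟨v, rfl⟩ := (Module.Flat.lTensor_exact N ex u).1 h4
  exact ⟨v, by rw [← LinearMap.comp_apply, LinearMap.rTensor_comp_lTensor]⟩

theorem comul_mem_HKer [IsCocomm K A] (f : A →ₐc[K] B) (a : HKer f) :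
    comul (R := K) (a : A) ∈ LinearMap.range (TensorProduct.map (HKer f).val.toLinearMap
      (HKer f).val.toLinearMap) := by
  let p : A →ₗ[K] B ⊗[K] A :=
    (coact f).toLinearMap - (Algebra.TensorProduct.includeRight : A →ₐ[K] B ⊗[K] A).toLinearMap
  have hp : Subalgebra.toSubmodule (HKer f) = LinearMap.ker p := by
    ext x
    simp only [p, LinearMap.mem_ker, LinearMap.sub_apply, sub_eq_zero]
    rfl
  have h1 : p.rTensor A (comul (R := K) (a : A)) = 0 := by
    have ha : p (a : A) = 0 := by
      rw [← LinearMap.mem_ker, ← hp]; exact a.2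
    have h := congr((TensorProduct.assoc K B A A).symm ((comul (R := K)).lTensor B $ha))
    rw [map_zero, map_zero] at h
    rw [← h]
    simp only [p, LinearMap.rTensor_sub, LinearMap.sub_apply, map_sub]
    congr 1
    · have hc := coassoc_symm_apply (R := K) (a : A)
      have : ∀ z : A ⊗[K] A, (TensorProduct.assoc K B A A).symm
          (comul.lTensor B (TensorProduct.map (f : A →ₗ[K] B) LinearMap.id z)) =
          TensorProduct.map (TensorProduct.map (f : A →ₗ[K] B) LinearMap.id) LinearMap.id
          ((TensorProduct.assoc K A A A).symm (comul.lTensor A z)) := by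
        intro z
        induction z with
        | zero => simp
        | add x y hx hy => simp only [map_add, hx, hy]
        | tmul x y => 
          simp only [TensorProduct.map_tmul, LinearMap.lTensor_tmul, LinearMap.id_apply]
          generalize comul (R := K) y = w
          induction w with
          | zero => simp
          | add x y hx hy => simp only [map_add, TensorProduct.tmul_add, hx, hy]
          | tmul x y => simp
      have h3 := this (comul (a : A))
      rw [hc] at h3
      refine Eq.trans ?_ h3.symm
      generalize comul (R := K) (a : A) = z
      induction z with
      | zero => simp
      | add x y hx hy => simp only [map_add, hx, hy]
      | tmul x y => rfl
  have h2 : p.lTensor A (comul (R := K) (a : A)) = 0 := by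
    rw [← comm_comul K (a : A)]
    have : ∀ z : A ⊗[K] A, p.lTensor A (TensorProduct.comm K A A z) =
        TensorProduct.comm K _ _ (p.rTensor A z) := by
      intro z
      induction z with
      | zero => simp
      | add x y hx hy => simp only [map_add, hx, hy]
      | tmul x y => simp
    rw [this, h1, map_zero]
  exact mem_range_map_subtype p _ hp _ h1 h2

section HKerHopf

variable [IsCocomm K A] (f : A →ₐc[K] B)

theorem hker_map_injective :
    Function.Injective (TensorProduct.map (HKer f).val.toLinearMap (HKer f).val.toLinearMap) :=
  TensorProduct.map_injective_of_flat_flat _ _ Subtype.val_injective Subtype.val_injective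

/-- The comultiplication of `A`, restricted to the Hopf kernel. -/
noncomputable def hkerComul : HKer f →ₗ[K] HKer f ⊗[K] HKer f :=
  (LinearEquiv.ofInjective _ (hker_map_injective f)).symm.toLinearMap ∘ₗ
    (comul ∘ₗ (HKer f).val.toLinearMap).codRestrict _ (comul_mem_HKer f)

theorem map_hkerComul (a : HKer f) :
    TensorProduct.map (HKer f).val.toLinearMap (HKer f).val.toLinearMap (hkerComul f a) =
      comul (R := K) (a : A) :=
  LinearEquiv.ofInjective_symm_apply _ (h := hker_map_injective f) ⟨_, comul_mem_HKer f a⟩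

noncomputable instance : Coalgebra K (HKer f) where
  comul := hkerComul f
  counit := counit ∘ₗ (HKer f).val.toLinearMap
  coassoc := by
    have inj : Function.Injective (TensorProduct.map (HKer f).val.toLinearMap
        (TensorProduct.map (HKer f).val.toLinearMap (HKer f).val.toLinearMap)) :=
      TensorProduct.map_injective_of_flat_flat _ _ Subtype.val_injective (hker_map_injective f)
    ext a
    apply inj
    have h := coassoc_apply (R := K) (a : A)
    rw [← map_hkerComul] at h
    simp only [LinearMap.comp_apply, LinearEquiv.coe_coe]
    generalize hkerComul f a = z at h ⊢
    have e1 : ∀ z : HKer f ⊗[K] HKer f, TensorProduct.map (HKer f).val.toLinearMap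
        (TensorProduct.map (HKer f).val.toLinearMap (HKer f).val.toLinearMap)
        (TensorProduct.assoc K _ _ _ ((hkerComul f).rTensor _ z)) =
        TensorProduct.assoc K _ _ _ (comul.rTensor A (TensorProduct.map
          (HKer f).val.toLinearMap (HKer f).val.toLinearMap z)) := by
      intro z
      induction z with
      | zero => simp
      | add x y hx hy => simp only [map_add, hx, hy]
      | tmul x y =>
        have hx := map_hkerComul f x
        simp only [LinearMap.rTensor_tmul, TensorProduct.map_tmul]
        change _ = TensorProduct.assoc K A A A (comul (x : A) ⊗ₜ (y : A))
        rw [← hx]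
        generalize hkerComul f x = w
        induction w with
        | zero => simp
        | add x y hx hy => simp only [map_add, TensorProduct.add_tmul, hx, hy]
        | tmul x y => rfl
    have e2 : ∀ z : HKer f ⊗[K] HKer f, TensorProduct.map (HKer f).val.toLinearMap
        (TensorProduct.map (HKer f).val.toLinearMap (HKer f).val.toLinearMap)
        ((hkerComul f).lTensor _ z) =
        comul.lTensor A (TensorProduct.map
          (HKer f).val.toLinearMap (HKer f).val.toLinearMap z) := by
      intro z
      induction z with
      | zero => simp
      | add x y hx hy => simp only [map_add, hx, hy]
      | tmul x y =>
        have hx := map_hkerComul f y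
        simp only [LinearMap.lTensor_tmul, TensorProduct.map_tmul, hx]
        rfl
    rw [e1, e2, h]
  rTensor_counit_comp_comul := by
    ext a
    apply Module.Flat.lTensor_preserves_injective_linearMap (M := K) (HKer f).val.toLinearMap
      Subtype.val_injective
    have h := rTensor_counit_comul (R := K) (a : A)
    rw [← map_hkerComul] at h
    simp only [LinearMap.comp_apply]
    refine Eq.trans ?_ h
    generalize hkerComul f a = z
    induction z with
    | zero => simp
    | add x y hx hy => simp only [map_add, hx, hy]
    | tmul x y => rfl
  lTensor_counit_comp_comul := by
    ext a
    apply Module.Flat.rTensor_preserves_injective_linearMap (M := K) (HKer f).val.toLinearMap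
      Subtype.val_injective
    have h := lTensor_counit_comul (R := K) (a : A)
    rw [← map_hkerComul] at h
    simp only [LinearMap.comp_apply]
    refine Eq.trans ?_ h
    generalize hkerComul f a = z
    induction z with
    | zero => simp
    | add x y hx hy => simp only [map_add, hx, hy]
    | tmul x y => rfl

noncomputable instance : Bialgebra K (HKer f) :=
  Bialgebra.mk' K (HKer f)
    (counit_one (R := K) (A := A))
    (fun {a b} => counit_mul (R := K) (a : A) (b : A))
    (hker_map_injective f <| by
      refine (map_hkerComul f 1).trans ?_
      exact (comul_one (R := K) (A := A)).trans
        (map_one (Algebra.TensorProduct.map (HKer f).val (HKer f).val)).symm)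
    (fun {a b} => hker_map_injective f <| by
      refine (map_hkerComul f (a * b)).trans ?_
      refine (comul_mul (R := K) (a : A) (b : A)).trans ?_
      rw [← map_hkerComul, ← map_hkerComul]
      exact (map_mul (Algebra.TensorProduct.map (HKer f).val (HKer f).val) _ _).symm)

/-- The Hopf kernel is a Hopf subalgebra. -/
noncomputable instance : HopfAlgebra K (HKer f) where
  antipode := ((antipode K ∘ₗ (HKer f).val.toLinearMap).codRestrict
    (Subalgebra.toSubmodule (HKer f)) fun a => antipode_mem_HKer f a.2)
  mul_antipode_rTensor_comul := by
    ext a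
    have h := mul_antipode_rTensor_comul_apply (R := K) (a : A)
    rw [← map_hkerComul] at h
    refine Eq.trans ?_ h
    change (HKer f).val.toLinearMap (LinearMap.mul' K _ (LinearMap.rTensor _ _ (hkerComul f a))) = _
    generalize hkerComul f a = z
    induction z with
    | zero => simp
    | add x y hx hy => simp only [map_add, hx, hy]
    | tmul x y => rfl
  mul_antipode_lTensor_comul := by
    ext a
    have h := mul_antipode_lTensor_comul_apply (R := K) (a : A)
    rw [← map_hkerComul] at h
    refine Eq.trans ?_ h
    change (HKer f).val.toLinearMap (LinearMap.mul' K _ (LinearMap.lTensor _ _ (hkerComul f a))) = _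
    generalize hkerComul f a = z
    induction z with
    | zero => simp
    | add x y hx hy => simp only [map_add, hx, hy]
    | tmul x y => rfl

instance : IsCocomm K (HKer f) where
  comm_comp_comul := by
    ext a
    apply hker_map_injective f
    have h := comm_comul K (a : A)
    have ha : TensorProduct.map (HKer f).val.toLinearMap (HKer f).val.toLinearMap
      (comul (R := K) a) = comul (R := K) (a : A) := map_hkerComul f a
    rw [ha, ← h, ← ha]
    simp only [LinearMap.comp_apply]
    generalize comul (R := K) a = z
    induction z with
    | zero => simp
    | add x y hx hy => simp only [map_add, hx, hy]
    | tmul x y => rfl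

/-- The inclusion `hker f : HKer f → A`. -/
noncomputable def hker : HKer f →ₐc[K] A where
  toFun := Subtype.val
  map_smul' _ _ := rfl
  map_add' _ _ := rfl
  map_one' := rfl
  map_mul' _ _ := rfl
  counit_comp := rfl
  map_comp_comul := LinearMap.ext (map_hkerComul f)

end HKerHopf

/-- `X` is a `B`-module Hopf algebra under `ξ`, written `ξ b x = ᵇx`. -/
structure IsModuleHopf (ξ : B →ₗ[K] A →ₗ[K] A) : Prop where
  mul_act : ∀ b b' x, ξ (b * b') x = ξ b (ξ b' x)
  one_act : ∀ x, ξ 1 x = x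
  /-- `ᵇ(xy) = (ᵇ¹x)(ᵇ²y)` -/
  act_mul : ∀ b x y, ξ b (x * y) =
    LinearMap.mul' K A (TensorProduct.map (ξ.flip x) (ξ.flip y) (comul b))
  act_one : ∀ b, ξ b 1 = counit (R := K) b • (1 : A)
  /-- `Δ(ᵇx) = ᵇ¹x₁ ⊗ ᵇ²x₂` -/
  comul_act : ∀ b x, comul (R := K) (ξ b x) = TensorProduct.map₂ ξ ξ (comul b) (comul x)
  counit_act : ∀ b x, counit (R := K) (ξ b x) = counit (R := K) b * counit (R := K) x

section KerAct

variable [IsCocomm K A] (f : A →ₐc[K] B) (i : B →ₐc[K] A)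

/-- The action of `B` on `HKer f` by conjugation, `ᵇk = i(b₁) k i(S(b₂))`. -/
noncomputable def kerAct : B →ₗ[K] HKer f →ₗ[K] HKer f :=
  LinearMap.mk₂ K (fun b k => ⟨ad K (i b) k, ad_mem_HKer f (i b) k.2⟩)
    (fun _ _ _ => Subtype.ext (by simp)) (fun _ _ _ => Subtype.ext (by simp))
    (fun _ _ _ => Subtype.ext (by simp)) (fun _ _ _ => Subtype.ext (by simp))

theorem coe_kerAct (b : B) (k : HKer f) : (kerAct f i b k : A) = ad K (i b) (k : A) := rfl

theorem coe_kerAct_repr {ι : Type*} {b : B} (r : Coalgebra.Repr K b ι) (k : HKer f) :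
    (kerAct f i b k : A) = ∑ j ∈ r.index, i (r.left j) * k * i (antipode K (r.right j)) := by
  rw [coe_kerAct, ad_repr (r.induced i)]
  simp [map_antipode]

theorem kerAct_isModuleHopf : IsModuleHopf (kerAct f i) where
  mul_act b b' x := Subtype.ext (by simp [coe_kerAct])
  one_act x := Subtype.ext (by simp [coe_kerAct])
  act_mul b x y := by
    apply Subtype.ext
    rw [coe_kerAct, Subalgebra.coe_mul, ad_mul ((ℛ K b).induced i), ← (ℛ K b).eq]
    simp [coe_kerAct]
  act_one b := by
    apply Subtype.ext
    rw [coe_kerAct, Subalgebra.coe_one, ad_one]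
    simp [Algebra.algebraMap_eq_smul_one]
  comul_act b x := by
    apply hker_map_injective f
    refine (map_hkerComul f _).trans ?_
    have hx := map_hkerComul f x
    change TensorProduct.map (HKer f).val.toLinearMap (HKer f).val.toLinearMap (comul x) = _ at hx
    rw [coe_kerAct, comul_ad, ← hx, ← CoalgHomClass.map_comp_comul_apply]
    generalize comul (R := K) b = u
    generalize comul (R := K) x = v
    induction u with
    | zero => simp
    | add u u' h h' => simp only [map_add, LinearMap.add_apply, h, h']
    | tmul u u' =>
      induction v with
      | zero => simp
      | add v v' h h' => simp only [map_add, h, h']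
      | tmul v v' => rfl
  counit_act b x := by
    refine (counit_ad (i b) (x : A)).trans ?_
    rw [CoalgHomClass.counit_comp_apply]
    rfl

end KerAct

end Basics

section SmashDef

variable {K : Type u} [Field K] {A B : Type v} [Ring A] [HopfAlgebra K A]
  [Ring B] [HopfAlgebra K B] {ξ : B →ₗ[K] A →ₗ[K] A}

variable (ξ) in
/-- `(b ⊗ b') ⊗ (a ⊗ c) ↦ ᵇa ⊗ b'c`. -/
noncomputable def twistAux : B ⊗[K] B →ₗ[K] A ⊗[K] B →ₗ[K] A ⊗[K] B :=
  TensorProduct.homTensorHomMap (RingHom.id K) A B A B ∘ₗ TensorProduct.map ξ (LinearMap.mul K B)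

variable (ξ) in
/-- `b ⊗ (a ⊗ c) ↦ ᵇ¹a ⊗ b₂c`. -/
noncomputable def twist : B →ₗ[K] A ⊗[K] B →ₗ[K] A ⊗[K] B := twistAux ξ ∘ₗ comul

theorem twist_tmul {ι : Type*} {b : B} (r : Coalgebra.Repr K b ι) (a : A) (c : B) :
    twist ξ b (a ⊗ₜ c) = ∑ j ∈ r.index, ξ (r.left j) a ⊗ₜ[K] (r.right j * c) := by
  simp [twist, twistAux, ← r.eq]

variable (K A B) in
/-- `x ⊗ (a ⊗ c) ↦ xa ⊗ c`. -/
noncomputable def mulL : A →ₗ[K] A ⊗[K] B →ₗ[K] A ⊗[K] B :=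
  LinearMap.rTensorHom B ∘ₗ LinearMap.mul K A

theorem mulL_tmul (x a : A) (c : B) : mulL K A B x (a ⊗ₜ c) = (x * a) ⊗ₜ c := rfl

theorem mulL_mul (x y : A) (w : A ⊗[K] B) :
    mulL K A B (x * y) w = mulL K A B x (mulL K A B y w) := by
  induction w with
  | zero => simp
  | add w w' h h' => simp only [map_add, h, h']
  | tmul a c => simp [mulL_tmul, mul_assoc]

variable (ξ) in
/-- The multiplication of the smash product, `(a ⊗ b) (a' ⊗ b') = a (ᵇ¹a') ⊗ b₂ b'`. -/
noncomputable def smashMul : A ⊗[K] B →ₗ[K] A ⊗[K] B →ₗ[K] A ⊗[K] B :=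
  TensorProduct.lift
    ((LinearMap.llcomp K (A ⊗[K] B) (A ⊗[K] B) (A ⊗[K] B) ∘ₗ mulL K A B).compl₂ (twist ξ))

theorem smashMul_tmul (x : A) (b : B) (w : A ⊗[K] B) :
    smashMul ξ (x ⊗ₜ b) w = mulL K A B x (twist ξ b w) := rfl

theorem smashMul_tmul_tmul {ι : Type*} {b : B} (r : Coalgebra.Repr K b ι) (a a' : A) (b' : B) :
    smashMul ξ (a ⊗ₜ b) (a' ⊗ₜ b') =
      ∑ j ∈ r.index, (a * ξ (r.left j) a') ⊗ₜ[K] (r.right j * b') := by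
  simp [smashMul_tmul, twist_tmul r, mulL_tmul]

theorem twist_one (h : IsModuleHopf ξ) (w : A ⊗[K] B) : twist ξ 1 w = w := by
  induction w with
  | zero => simp
  | add w w' h h' => simp only [map_add, h, h']
  | tmul a c => simp [twist, twistAux, Algebra.TensorProduct.one_def, h.one_act]

theorem twist_mul (h : IsModuleHopf ξ) (b c : B) (w : A ⊗[K] B) : twist ξ (b * c) w = twist ξ b (twist ξ c w) := by
  simp only [twist, LinearMap.comp_apply, Bialgebra.comul_mul]
  generalize comul (R := K) b = u
  generalize comul (R := K) c = v
  induction u with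
  | zero => simp
  | add w w' h h' => simp only [map_add, add_mul, LinearMap.add_apply, h, h']
  | tmul b b' =>
  induction v with
  | zero => simp
  | add w w' h h' => simp only [map_add, mul_add, LinearMap.add_apply, h, h']
  | tmul c c' =>
  induction w with
  | zero => simp
  | add w w' h h' => simp only [map_add, h, h']
  | tmul x y => simp [twistAux, h.mul_act, mul_assoc]

theorem twist_mulL (h : IsModuleHopf ξ) (b : B) (x : A) (w : A ⊗[K] B) :
    twist ξ b (mulL K A B x w) = LinearMap.mul' K (Module.End K (A ⊗[K] B))
      (TensorProduct.map (mulL K A B ∘ₗ ξ.flip x) (twist ξ) (comul b)) w := by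
  induction w with
  | zero => simp
  | add w w' h h' => simp only [map_add, h, h']
  | tmul z d =>
  let Φ : B ⊗[K] (B ⊗[K] B) →ₗ[K] A ⊗[K] B :=
    (LinearMap.mul' K A).rTensor B ∘ₗ (TensorProduct.assoc K A A B).symm.toLinearMap ∘ₗ
      TensorProduct.map (ξ.flip x) (TensorProduct.map (ξ.flip z) (LinearMap.mulRight K d))
  have hc := congr(Φ $(sum_tmul_tmul_eq (ℛ K b) (fun j => ℛ K ((ℛ K b).left j))
    (fun j => ℛ K ((ℛ K b).right j))))
  rw [mulL_tmul, twist_tmul (ℛ K b)]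
  conv_rhs => rw [← (ℛ K b).eq]
  simp only [map_sum, TensorProduct.map_tmul, LinearMap.mul'_apply, LinearMap.sum_apply,
    Module.End.mul_apply, LinearMap.comp_apply, LinearMap.flip_apply]
  have e1 : ∀ j, ξ ((ℛ K b).left j) (x * z) = ∑ k ∈ (ℛ K ((ℛ K b).left j)).index,
      ξ ((ℛ K ((ℛ K b).left j)).left k) x * ξ ((ℛ K ((ℛ K b).left j)).right k) z := by
    intro j
    rw [h.act_mul, ← (ℛ K ((ℛ K b).left j)).eq]
    simp
  simp only [e1, twist_tmul (ℛ K ((ℛ K b).right _)), map_sum, mulL_tmul, TensorProduct.sum_tmul]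
  simpa [Φ] using hc

theorem smashMul_assoc (h : IsModuleHopf ξ) (u v w : A ⊗[K] B) :
    smashMul ξ (smashMul ξ u v) w = smashMul ξ u (smashMul ξ v w) := by
  induction u with
  | zero => simp
  | add w w' h h' => simp only [map_add, LinearMap.add_apply, h, h']
  | tmul x b =>
  induction v with
  | zero => simp
  | add w w' h h' => simp only [map_add, LinearMap.add_apply, h, h']
  | tmul y c =>
  rw [smashMul_tmul y c, smashMul_tmul x b (mulL K A B _ _), twist_mulL h,
    smashMul_tmul_tmul (ℛ K b)]
  conv_rhs => rw [← (ℛ K b).eq]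
  simp [smashMul_tmul, mulL_mul, twist_mul h]

theorem one_smashMul (h : IsModuleHopf ξ) (w : A ⊗[K] B) : smashMul ξ (1 ⊗ₜ 1) w = w := by
  rw [smashMul_tmul, twist_one h]
  induction w with
  | zero => simp
  | add w w' h h' => simp only [map_add, h, h']
  | tmul a c => simp [mulL_tmul]

theorem twist_one_tmul (h : IsModuleHopf ξ) (b c : B) : twist ξ b (1 ⊗ₜ c) = 1 ⊗ₜ[K] (b * c) := by
  rw [twist_tmul (ℛ K b)]
  conv_rhs => rw [← sum_counit_smul (ℛ K b)]
  simp [h.act_one, Finset.sum_mul, TensorProduct.tmul_sum, TensorProduct.smul_tmul]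

theorem smashMul_one (h : IsModuleHopf ξ) (w : A ⊗[K] B) : smashMul ξ w (1 ⊗ₜ 1) = w := by
  induction w with
  | zero => simp
  | add w w' h h' => simp only [map_add, LinearMap.add_apply, h, h']
  | tmul a c => simp [smashMul_tmul, twist_one_tmul h, mulL_tmul]

theorem counit_smashMul (h : IsModuleHopf ξ) (u v : A ⊗[K] B) :
    counit (R := K) (smashMul ξ u v) = counit (R := K) u * counit (R := K) v := by
  induction u with
  | zero => simp
  | add w w' h h' => simp only [map_add, LinearMap.add_apply, add_mul, h, h']
  | tmul x b =>
  induction v with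
  | zero => simp
  | add w w' h h' => simp only [map_add, mul_add, h, h']
  | tmul y c =>
  rw [smashMul_tmul_tmul (ℛ K b)]
  simp only [map_sum, TensorProduct.counit_tmul, Bialgebra.counit_mul, h.counit_act, smul_eq_mul]
  conv_rhs => rw [← sum_counit_smul (ℛ K b)]
  simp only [map_sum, map_smul, smul_eq_mul, Finset.sum_mul]
  exact Finset.sum_congr rfl fun _ _ => by ring

theorem comul_mulL (x : A) (w : A ⊗[K] B) : comul (R := K) (mulL K A B x w) =
    TensorProduct.map₂ (mulL K A B) (mulL K A B) (comul x) (comul w) := by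
  induction w with
  | zero => simp
  | add w w' h h' => simp only [map_add, h, h']
  | tmul a c =>
  simp only [mulL_tmul, TensorProduct.comul_tmul, Bialgebra.comul_mul]
  generalize comul (R := K) x = u
  generalize comul (R := K) a = v
  generalize comul (R := K) c = w
  induction u with
  | zero => simp
  | add w w' h h' => simp only [map_add, add_mul, LinearMap.add_apply, TensorProduct.add_tmul, h, h']
  | tmul x x' =>
  induction v with
  | zero => simp
  | add w w' h h' => simp only [map_add, mul_add, TensorProduct.add_tmul, h, h']
  | tmul a a' =>
  induction w with
  | zero => simp
  | add w w' h h' => simp only [map_add, TensorProduct.tmul_add, h, h']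
  | tmul c c' => rw [Algebra.TensorProduct.tmul_mul_tmul]; rfl

theorem comul_twistAux (h : IsModuleHopf ξ) (z : B ⊗[K] B) (w : A ⊗[K] B) : comul (R := K) (twistAux ξ z w) =
    TensorProduct.map₂ (twistAux ξ) (twistAux ξ) (comul z) (comul w) := by
  induction z with
  | zero => simp
  | add w w' h h' => simp only [map_add, LinearMap.add_apply, h, h']
  | tmul p q =>
  induction w with
  | zero => simp
  | add w w' h h' => simp only [map_add, h, h']
  | tmul a c =>
  have e : twistAux ξ (p ⊗ₜ q) (a ⊗ₜ c) = ξ p a ⊗ₜ (q * c) := rfl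
  simp only [e, TensorProduct.comul_tmul, Bialgebra.comul_mul, h.comul_act]
  generalize comul (R := K) p = p
  generalize comul (R := K) q = q
  generalize comul (R := K) a = a
  generalize comul (R := K) c = c
  induction p with
  | zero => simp
  | add w w' h h' => simp only [map_add, LinearMap.add_apply, TensorProduct.add_tmul, h, h']
  | tmul p p' =>
  induction q with
  | zero => simp
  | add w w' h h' => simp only [map_add, add_mul, LinearMap.add_apply, TensorProduct.tmul_add, h, h']
  | tmul q q' =>
  induction a with
  | zero => simp
  | add w w' h h' => simp only [map_add, TensorProduct.add_tmul, h, h']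
  | tmul a a' =>
  induction c with
  | zero => simp
  | add w w' h h' => simp only [map_add, mul_add, TensorProduct.tmul_add, h, h']
  | tmul c c' => rw [Algebra.TensorProduct.tmul_mul_tmul]; rfl

theorem comul_twist (h : IsModuleHopf ξ) [IsCocomm K B] (b : B) (w : A ⊗[K] B) : comul (R := K) (twist ξ b w) =
    TensorProduct.map₂ (twist ξ) (twist ξ) (comul b) (comul w) := by
  have hc := CoalgHomClass.map_comp_comul_apply (comulCoalgHom K B) b
  change TensorProduct.map comul comul (comul b) = comul (R := K) (comul (R := K) b) at hc
  rw [twist, LinearMap.comp_apply, comul_twistAux h, ← hc]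
  generalize comul (R := K) b = u
  induction u with
  | zero => simp
  | add w w' h h' => simp only [map_add, LinearMap.add_apply, h, h']
  | tmul p q =>
  rw [TensorProduct.map_tmul]
  generalize comul (R := K) w = v
  induction v with
  | zero => simp
  | add w w' h h' => simp only [map_add, h, h']
  | tmul v v' => rfl

theorem comul_smashMul (h : IsModuleHopf ξ) [IsCocomm K B] (u v : A ⊗[K] B) : comul (R := K) (smashMul ξ u v) =
    TensorProduct.map₂ (smashMul ξ) (smashMul ξ) (comul u) (comul v) := by
  induction u with
  | zero => simp
  | add w w' h h' => simp only [map_add, LinearMap.add_apply, h, h']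
  | tmul x b =>
  rw [smashMul_tmul, comul_mulL, comul_twist h, TensorProduct.comul_tmul]
  generalize comul (R := K) x = x
  generalize comul (R := K) b = b
  generalize comul (R := K) v = v
  induction x with
  | zero => simp
  | add w w' h h' => simp only [map_add, LinearMap.add_apply, TensorProduct.add_tmul, h, h']
  | tmul x x' =>
  induction b with
  | zero => simp
  | add w w' h h' => simp only [map_add, LinearMap.add_apply, TensorProduct.tmul_add, h, h']
  | tmul b b' =>
  induction v with
  | zero => simp
  | add w w' h h' => simp only [map_add, h, h']
  | tmul v v' => rfl

end SmashDef

section Smash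

variable {K : Type u} [Field K] {A B : Type v} [Ring A] [HopfAlgebra K A]
  [Ring B] [HopfAlgebra K B] {ξ : B →ₗ[K] A →ₗ[K] A}

/-- The smash product `A ⋊ B`: the vector space `A ⊗ B` with the tensor product coalgebra
structure and the multiplication `(a ⊗ b) (a' ⊗ b') = a (ᵇ¹a') ⊗ b₂ b'`. -/
@[nolint unusedArguments]
def Smash (_ : IsModuleHopf ξ) : Type v := A ⊗[K] B

variable (h : IsModuleHopf ξ)

noncomputable instance : AddCommGroup (Smash h) := inferInstanceAs (AddCommGroup (A ⊗[K] B))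

noncomputable instance : Ring (Smash h) where
  __ := (inferInstance : AddCommGroup (Smash h))
  mul u v := smashMul ξ u v
  one := (1 ⊗ₜ[K] 1 : A ⊗[K] B)
  left_distrib u v w := map_add (smashMul ξ u) v w
  right_distrib u v w := LinearMap.map_add₂ (smashMul ξ) u v w
  zero_mul u := LinearMap.map_zero₂ (smashMul ξ) u
  mul_zero u := map_zero (smashMul ξ u)
  mul_assoc := smashMul_assoc h
  one_mul := one_smashMul h
  mul_one := smashMul_one h

noncomputable instance : Algebra K (Smash h) :=
  letI : Module K (Smash h) := (inferInstance : Module K (A ⊗[K] B))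
  Algebra.ofModule (fun r u v => LinearMap.map_smul₂ (smashMul ξ) r u v)
    (fun r u v => map_smul (smashMul ξ u) r v)

noncomputable instance : Coalgebra K (Smash h) := (inferInstance : Coalgebra K (A ⊗[K] B))

instance [IsCocomm K A] [IsCocomm K B] : IsCocomm K (Smash h) :=
  (inferInstance : IsCocomm K (A ⊗[K] B))

noncomputable instance [IsCocomm K B] : Bialgebra K (Smash h) :=
  Bialgebra.mk' K (Smash h)
    (counit_one (R := K) (A := A ⊗[K] B))
    (fun {u v} => counit_smashMul h u v)
    (comul_one (R := K) (A := A ⊗[K] B))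
    (fun {u v} => by
      refine (comul_smashMul h u v).trans ?_
      change _ = comul (R := K) u * comul (R := K) v
      have key : ∀ x y : Smash h ⊗[K] Smash h,
          TensorProduct.map₂ (LinearMap.mul K (Smash h)) (LinearMap.mul K (Smash h)) x y =
            x * y := by
        intro x y
        induction x with
        | zero => simp
        | add w w' h h' => simp only [map_add, LinearMap.add_apply, add_mul, h, h']
        | tmul x x' =>
        induction y with
        | zero => simp
        | add w w' h h' => simp only [map_add, mul_add, h, h']
        | tmul y y' => simp
      exact key _ _)

/-- The inclusion `a ↦ a ⊗ 1`. -/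
noncomputable def smashInl : A →ₐ[K] Smash h :=
  AlgHom.ofLinearMap ((TensorProduct.mk K A B).flip 1) rfl fun x y => by
    change (x * y) ⊗ₜ[K] (1 : B) = smashMul ξ (x ⊗ₜ 1) (y ⊗ₜ 1)
    rw [smashMul_tmul, twist_one h, mulL_tmul]

/-- The inclusion `b ↦ 1 ⊗ b`. -/
noncomputable def smashInr : B →ₐ[K] Smash h :=
  AlgHom.ofLinearMap (TensorProduct.mk K A B 1) rfl fun x y => by
    change (1 : A) ⊗ₜ[K] (x * y) = smashMul ξ (1 ⊗ₜ x) (1 ⊗ₜ y)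
    rw [smashMul_tmul, twist_one_tmul h, mulL_tmul, one_mul]

/-- The projection `a ⊗ b ↦ ε(b) a`. -/
noncomputable def smashFst : Smash h →ₗc[K] A :=
  (Coalgebra.TensorProduct.rid K K A : A ⊗[K] K →ₗc[K] A).comp
    (Coalgebra.TensorProduct.map (CoalgHom.id K A) (counitCoalgHom K B))

/-- The projection `a ⊗ b ↦ ε(a) b`. -/
noncomputable def smashSnd : Smash h →ₗc[K] B :=
  (Coalgebra.TensorProduct.lid K B : K ⊗[K] B →ₗc[K] B).comp
    (Coalgebra.TensorProduct.map (counitCoalgHom K A) (CoalgHom.id K B))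

/-- The antipode of the smash product, `S(a ⊗ b) = (1 ⊗ S(b)) (S(a) ⊗ 1)`. -/
noncomputable def smashAntipode : Smash h →ₗ[K] Smash h :=
  TensorProduct.lift (LinearMap.mk₂ K
    (fun a b => smashInr h (antipode K b) * smashInl h (antipode K a))
    (by simp [mul_add]) (by simp) (by simp [add_mul]) (by simp))

theorem sum_counit_smul_left {C ι : Type*} [AddCommGroup C] [Module K C] [Coalgebra K C] {c : C}
    (r : Coalgebra.Repr K c ι) :
    ∑ j ∈ r.index, counit (R := K) (r.right j) • r.left j = c := by
  have e := congr(TensorProduct.rid K C $(sum_tmul_counit_eq r))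
  simp only [map_sum, TensorProduct.rid_tmul, one_smul] at e
  exact e

theorem smash_id_eq : (toConv LinearMap.id : WithConv (Smash h →ₗ[K] Smash h)) =
    toConv ((smashInl h).toLinearMap ∘ₗ (smashFst h).toLinearMap) *
      toConv ((smashInr h).toLinearMap ∘ₗ (smashSnd h).toLinearMap) := by
  apply WithConv.ofConv_injective
  refine TensorProduct.ext' (M := A) (N := B) fun a b => ?_
  have e : ∀ (x : A) (y : B), smashInl h x * smashInr h y = (x ⊗ₜ[K] y : A ⊗[K] B) := by
    intro x y
    change smashMul ξ (x ⊗ₜ 1) (1 ⊗ₜ y) = _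
    rw [smashMul_tmul, twist_one h, mulL_tmul, mul_one]
  refine Eq.trans ?_ (Coalgebra.Repr.convMul_apply
    (((ℛ K a).tmul (ℛ K b) : Coalgebra.Repr K (a ⊗ₜ[K] b : A ⊗[K] B) _)) 
    (toConv ((smashInl h).toLinearMap ∘ₗ (smashFst h).toLinearMap))
      (toConv ((smashInr h).toLinearMap ∘ₗ (smashSnd h).toLinearMap))).symm
  have e2 : ∀ (x x' : A) (y y' : B),
      (toConv ((smashInl h).toLinearMap ∘ₗ (smashFst h).toLinearMap)) (x ⊗ₜ[K] y : A ⊗[K] B) *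
      (toConv ((smashInr h).toLinearMap ∘ₗ (smashSnd h).toLinearMap)) (x' ⊗ₜ[K] y' : A ⊗[K] B) =
      ((counit (R := K) x' • x) ⊗ₜ[K] (counit (R := K) y • y') : A ⊗[K] B) := by
    intro x x' y y'
    have e3 := e (counit (R := K) y • x) (counit (R := K) x' • y')
    refine e3.trans ?_
    rw [TensorProduct.smul_tmul_smul, TensorProduct.smul_tmul_smul, mul_comm]
  simp only [Coalgebra.Repr.tmul_index, Coalgebra.Repr.tmul_left, Coalgebra.Repr.tmul_right]
  refine Eq.trans ?_ (Finset.sum_congr rfl fun i _ => (e2 _ _ _ _).symm)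
  change a ⊗ₜ[K] b = _
  conv_lhs => rw [← sum_counit_smul_left (ℛ K a), ← sum_counit_smul (ℛ K b)]
  rw [TensorProduct.sum_tmul]
  simp only [TensorProduct.tmul_sum]
  exact (Finset.sum_product (ℛ K a).index (ℛ K b).index (fun i : (A × A) × (B × B) =>
    ((counit (R := K) ((ℛ K a).right i.1) • (ℛ K a).left i.1) ⊗ₜ[K]
      (counit (R := K) ((ℛ K b).left i.2) • (ℛ K b).right i.2) : A ⊗[K] B))).symm

theorem smash_antipode_eq : toConv (smashAntipode h) =
    toConv ((smashInr h).toLinearMap ∘ₗ antipode K ∘ₗ (smashSnd h).toLinearMap) *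
      toConv ((smashInl h).toLinearMap ∘ₗ antipode K ∘ₗ (smashFst h).toLinearMap) := by
  apply WithConv.ofConv_injective
  refine TensorProduct.ext' (M := A) (N := B) fun a b => ?_
  refine Eq.trans ?_ (Coalgebra.Repr.convMul_apply
    (((ℛ K a).tmul (ℛ K b) : Coalgebra.Repr K (a ⊗ₜ[K] b : A ⊗[K] B) _)) 
    (toConv ((smashInr h).toLinearMap ∘ₗ antipode K ∘ₗ (smashSnd h).toLinearMap))
    (toConv ((smashInl h).toLinearMap ∘ₗ antipode K ∘ₗ (smashFst h).toLinearMap))).symm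
  have e2 : ∀ (x x' : A) (y y' : B),
      (toConv ((smashInr h).toLinearMap ∘ₗ antipode K ∘ₗ (smashSnd h).toLinearMap))
        (x ⊗ₜ[K] y : A ⊗[K] B) *
      (toConv ((smashInl h).toLinearMap ∘ₗ antipode K ∘ₗ (smashFst h).toLinearMap))
        (x' ⊗ₜ[K] y' : A ⊗[K] B) =
      smashInr h (antipode K (counit (R := K) y' • y)) *
        smashInl h (antipode K (counit (R := K) x • x')) := by
    intro x x' y y'
    change smashInr h (antipode K (counit (R := K) x • y)) *
        smashInl h (antipode K (counit (R := K) y' • x')) = _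
    simp only [map_smul, smul_mul_assoc, mul_smul_comm, smul_smul, mul_comm]
  simp only [Coalgebra.Repr.tmul_index, Coalgebra.Repr.tmul_left, Coalgebra.Repr.tmul_right]
  refine Eq.trans ?_ (Finset.sum_congr rfl fun i _ => (e2 _ _ _ _).symm)
  change smashInr h (antipode K b) * smashInl h (antipode K a) = _
  conv_lhs => rw [← sum_counit_smul (ℛ K a), ← sum_counit_smul_left (ℛ K b)]
  rw [map_sum, map_sum, map_sum, map_sum, Finset.sum_mul_sum, Finset.sum_product, Finset.sum_comm]

theorem algHom_antipode_left {C D : Type*} [AddCommGroup C] [Module K C] [Coalgebra K C]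
    [Ring D] [Algebra K D] (j : A →ₐ[K] D) (p : C →ₗc[K] A) :
    toConv (j.toLinearMap ∘ₗ antipode K ∘ₗ p.toLinearMap) *
      toConv (j.toLinearMap ∘ₗ p.toLinearMap) = 1 := by
  have e := LinearMap.algHom_comp_convMul_distrib j
    (toConv (antipode K ∘ₗ p.toLinearMap)) (toConv p.toLinearMap)
  rw [antipode_conv_left] at e
  apply WithConv.ofConv_injective
  refine e.symm.trans ?_
  ext x
  exact j.commutes (counit x)

theorem algHom_antipode_right {C D : Type*} [AddCommGroup C] [Module K C] [Coalgebra K C]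
    [Ring D] [Algebra K D] (j : A →ₐ[K] D) (p : C →ₗc[K] A) :
    toConv (j.toLinearMap ∘ₗ p.toLinearMap) *
      toConv (j.toLinearMap ∘ₗ antipode K ∘ₗ p.toLinearMap) = 1 := by
  have e := LinearMap.algHom_comp_convMul_distrib j
    (toConv p.toLinearMap) (toConv (antipode K ∘ₗ p.toLinearMap))
  rw [antipode_conv_right] at e
  apply WithConv.ofConv_injective
  refine e.symm.trans ?_
  ext x
  exact j.commutes (counit x)

noncomputable instance [IsCocomm K A] [IsCocomm K B] : HopfAlgebra K (Smash h) where
  antipode := smashAntipode h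
  mul_antipode_rTensor_comul := by
    have e : toConv (smashAntipode h) * toConv LinearMap.id = 1 := by
      have e1 := algHom_antipode_left (smashInl h) (smashFst h)
      have e2 := algHom_antipode_left (smashInr h) (smashSnd h)
      rw [smash_id_eq h, smash_antipode_eq h, mul_assoc, 
        ← mul_assoc (toConv ((smashInl h).toLinearMap ∘ₗ antipode K ∘ₗ (smashFst h).toLinearMap)),
        e1, one_mul, e2]
    exact congr(($e).ofConv)
  mul_antipode_lTensor_comul := by
    have e : toConv LinearMap.id * toConv (smashAntipode h) = 1 := by
      have e1 := algHom_antipode_right (smashInl h) (smashFst h)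
      have e2 := algHom_antipode_right (smashInr h) (smashSnd h)
      rw [smash_id_eq h, smash_antipode_eq h, mul_assoc,
        ← mul_assoc (toConv ((smashInr h).toLinearMap ∘ₗ (smashSnd h).toLinearMap)),
        e2, one_mul, e1]
    exact congr(($e).ofConv)

end Smash

section Maps

variable {K : Type u} [Field K] {A B A' B' D : Type v} [Ring A] [HopfAlgebra K A]
  [Ring B] [HopfAlgebra K B] [Ring A'] [HopfAlgebra K A'] [Ring B'] [HopfAlgebra K B']
  [Ring D] [HopfAlgebra K D]

/-- `(b₁ z S(b₂)) b₃ = b z`. -/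
theorem sum_ad_mul {ι : Type*} {b : B} (r : Coalgebra.Repr K b ι) (z : B) :
    ∑ j ∈ r.index, ad K (r.left j) z * r.right j = b * z := by
  let I : WithConv (B →ₗ[K] B) := toConv LinearMap.id
  let S : WithConv (B →ₗ[K] B) := toConv (antipode K)
  have hT : toConv ((ad K).toLinearMap.flip z) = toConv (LinearMap.mulRight K z) * S := by
    ext a
    rw [(ℛ K a).convMul_apply]
    simp [ad_repr (ℛ K a), S]
  have hSI : S * I = 1 := LinearMap.antipode_mul_id
  have e : toConv ((ad K).toLinearMap.flip z) * I = toConv (LinearMap.mulRight K z) := by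
    rw [hT, mul_assoc, hSI, mul_one]
  have e1 := congr($e b)
  rw [r.convMul_apply] at e1
  exact e1

variable {ξ : B →ₗ[K] A →ₗ[K] A} {ξ' : B' →ₗ[K] A' →ₗ[K] A'}

theorem map_smashMul (g : A ⊗[K] B →ₗ[K] D)
    (hm : ∀ a b a' b', g (smashMul ξ (a ⊗ₜ b) (a' ⊗ₜ b')) = g (a ⊗ₜ b) * g (a' ⊗ₜ b'))
    (u v : A ⊗[K] B) : g (smashMul ξ u v) = g u * g v := by
  induction u with
  | zero => simp
  | add x y hx hy => simp only [map_add, LinearMap.add_apply, add_mul, hx, hy]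
  | tmul a b =>
  induction v with
  | zero => simp
  | add x y hx hy => simp only [map_add, mul_add, hx, hy]
  | tmul a' b' => exact hm a b a' b'

variable [IsCocomm K A] [IsCocomm K B] [IsCocomm K A'] [IsCocomm K B']
  (h : IsModuleHopf ξ) (h' : IsModuleHopf ξ')

/-- A coalgebra morphism on `A ⊗ B` that is multiplicative for the smash product. -/
noncomputable def smashLift (g : A ⊗[K] B →ₗc[K] D) (h1 : g (1 ⊗ₜ 1) = 1)
    (hm : ∀ a b a' b', g (smashMul ξ (a ⊗ₜ b) (a' ⊗ₜ b')) = g (a ⊗ₜ b) * g (a' ⊗ₜ b')) :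
    Smash h →ₐc[K] D :=
  { toFun := g
    map_add' := map_add g
    map_smul' := map_smul g
    counit_comp := g.counit_comp
    map_comp_comul := g.map_comp_comul
    map_one' := h1
    map_mul' := map_smashMul g.toLinearMap hm }

/-- `p₂ : A ⋊ B → B`, `p₂(a ⊗ b) = ε(a) b`. -/
noncomputable def smashDom : Smash h →ₐc[K] B :=
  smashLift h ((Coalgebra.TensorProduct.lid K B : K ⊗[K] B →ₗc[K] B).comp
    (Coalgebra.TensorProduct.map (counitCoalgHom K A) (CoalgHom.id K B)))
    (by simp) (by
      intro a b a' b'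
      rw [smashMul_tmul_tmul (ℛ K b)]
      conv_rhs => rw [← sum_counit_smul (ℛ K b)]
      simp [h.counit_act, smul_smul, Finset.sum_mul, Finset.smul_sum, TensorProduct.tmul_sum,
        mul_comm, mul_left_comm])

/-- `p₁ : A ⋊ B → B`, `p₁(a ⊗ b) = d(a) b`. -/
noncomputable def smashCod (d : A →ₐc[K] B) (hd : ∀ b a, d (ξ b a) = ad K b (d a)) :
    Smash h →ₐc[K] B :=
  smashLift h ((mulCoalgHom K B).comp
    (Coalgebra.TensorProduct.map (d : A →ₗc[K] B) (CoalgHom.id K B)))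
    (by simp) (by
      intro a b a' b'
      rw [smashMul_tmul_tmul (ℛ K b)]
      have e := sum_ad_mul (ℛ K b) (d a')
      simp only [CoalgHom.comp_apply, map_sum, Coalgebra.TensorProduct.map_tmul, mul_assoc,
        coe_mulCoalgHom, LinearMap.mul'_apply, CoalgHom.coe_id, id_eq]
      simp only [BialgHom.coe_toCoalgHom, map_mul, hd]
      rw [← mul_assoc b, ← e]
      simp [Finset.sum_mul, Finset.mul_sum, mul_assoc])

/-- `e : B → A ⋊ B`, `e(b) = 1 ⊗ b`. -/
noncomputable def smashUnit : B →ₐc[K] Smash h :=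
  { smashInr h with
    map_smul' := map_smul (smashInr h)
    counit_comp := by
      ext b
      change counit (R := K) ((1 : A) ⊗ₜ[K] b) = _
      simp
    map_comp_comul := by
      ext b
      change TensorProduct.map (TensorProduct.mk K A B 1) (TensorProduct.mk K A B 1)
        (comul (R := K) b) = comul (R := K) ((1 : A) ⊗ₜ[K] b)
      rw [TensorProduct.comul_tmul, Bialgebra.comul_one]
      generalize comul (R := K) b = z
      induction z with
      | zero => simp
      | add x y hx hy => simp only [map_add, TensorProduct.tmul_add, hx, hy]
      | tmul x y => rfl }

/-- The morphism `α ⊗ β : A ⋊ B → A' ⋊ B'`. -/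
noncomputable def smashMap (α : A →ₐc[K] A') (β : B →ₐc[K] B')
    (hαβ : ∀ b a, α (ξ b a) = ξ' (β b) (α a)) : Smash h →ₐc[K] Smash h' :=
  smashLift h (Coalgebra.TensorProduct.map (α : A →ₗc[K] A') (β : B →ₗc[K] B'))
    (by
      change α 1 ⊗ₜ[K] β 1 = (1 : A') ⊗ₜ[K] (1 : B')
      simp)
    (by
      intro a b a' b'
      change _ = smashMul ξ' (α a ⊗ₜ β b) (α a' ⊗ₜ β b')
      rw [smashMul_tmul_tmul (ℛ K b), smashMul_tmul_tmul ((ℛ K b).induced β)]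
      refine (map_sum (Coalgebra.TensorProduct.map (α : A →ₗc[K] A') (β : B →ₗc[K] B'))
        _ _).trans ?_
      refine Finset.sum_congr rfl fun j _ => ?_
      rw [Coalgebra.TensorProduct.map_tmul]
      simp [hαβ])

/-- The restriction of `g` to Hopf kernels. -/
noncomputable def hkerMap {f : A →ₐc[K] B} {f' : A' →ₐc[K] B'} (g : A →ₐc[K] A')
    (g₀ : B →ₐc[K] B') (hg : ∀ a, f' (g a) = g₀ (f a)) : HKer f →ₐc[K] HKer f' :=
  let φ : HKer f →ₐ[K] HKer f' := ((g : A →ₐ[K] A').comp (HKer f).val).codRestrict _ fun a => by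
    have ha := (mem_HKer f a).1 a.2
    have e := congr(TensorProduct.map (g₀ : B →ₗ[K] B') (g : A →ₗ[K] A') $ha)
    refine (mem_HKer f' _).2 ?_
    change TensorProduct.map (f' : A' →ₗ[K] B') LinearMap.id (comul (R := K) (g (a : A))) = _
    rw [← CoalgHomClass.map_comp_comul_apply]
    refine Eq.trans ?_ (e.trans ?_)
    · generalize comul (R := K) (a : A) = z
      induction z with
      | zero => simp
      | add x y hx hy => simp only [map_add, hx, hy]
      | tmul x y => simp [hg]
    · simp
  { φ with
    map_smul' := map_smul φ
    counit_comp := by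
      ext a
      exact CoalgHomClass.counit_comp_apply g (a : A)
    map_comp_comul := by
      ext a
      apply hker_map_injective f'
      refine Eq.trans ?_ (map_hkerComul f' (φ a)).symm
      refine Eq.trans ?_ (CoalgHomClass.map_comp_comul_apply g (a : A))
      rw [← map_hkerComul]
      change _ = TensorProduct.map _ _ (TensorProduct.map _ _ (comul a))
      simp only [LinearMap.comp_apply]
      generalize comul (R := K) a = z
      induction z with
      | zero => simp
      | add x y hx hy => simp only [map_add, hx, hy]
      | tmul x y => rfl }

theorem coe_hkerMap {f : A →ₐc[K] B} {f' : A' →ₐc[K] B'} (g : A →ₐc[K] A')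
    (g₀ : B →ₐc[K] B') (hg : ∀ a, f' (g a) = g₀ (f a)) (a : HKer f) :
    (hkerMap g g₀ hg a : A') = g a := rfl

end Maps

section Internal

variable (C : Type u) [Category.{v} C]

/-- A reflexive graph `A₁ ⇉ A₀` with domain `δ`, codomain `γ` and identities `i`. -/
structure ReflexiveGraph where
  A₁ : C
  A₀ : C
  δ : A₁ ⟶ A₀
  γ : A₁ ⟶ A₀
  i : A₀ ⟶ A₁
  i_δ : i ≫ δ = 𝟙 A₀
  i_γ : i ≫ γ = 𝟙 A₀

namespace ReflexiveGraph

variable {C}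

@[ext]
structure Hom (G H : ReflexiveGraph C) where
  f₁ : G.A₁ ⟶ H.A₁
  f₀ : G.A₀ ⟶ H.A₀
  comm_δ : f₁ ≫ H.δ = G.δ ≫ f₀
  comm_γ : f₁ ≫ H.γ = G.γ ≫ f₀
  comm_i : f₀ ≫ H.i = G.i ≫ f₁

instance : Category (ReflexiveGraph C) where
  Hom := Hom
  id G := ⟨𝟙 _, 𝟙 _, by simp, by simp, by simp⟩
  comp f g := ⟨f.f₁ ≫ g.f₁, f.f₀ ≫ g.f₀, by simp [g.comm_δ, reassoc_of% f.comm_δ],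
    by simp [g.comm_γ, reassoc_of% f.comm_γ], by simp [g.comm_i, reassoc_of% f.comm_i]⟩

end ReflexiveGraph

/-- An internal groupoid: a reflexive graph with a multiplication `m` on the pullback `P` of
`δ` and `γ`, where `m` composes `p₁` after `p₂`. Associativity is stated on generalized elements,
that is, for all composable triples of morphisms `f, g, h : T ⟶ A₁`. -/
structure InternalGroupoid extends ReflexiveGraph C where
  P : C
  p₁ : P ⟶ A₁
  p₂ : P ⟶ A₁
  isPullback : IsPullback p₁ p₂ δ γ
  m : P ⟶ A₁
  /-- `m (1, i δ) = 1` -/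
  m_id : isPullback.lift (𝟙 A₁) (δ ≫ i) (by simp [i_γ]) ≫ m = 𝟙 A₁
  /-- `m (i γ, 1) = 1` -/
  id_m : isPullback.lift (γ ≫ i) (𝟙 A₁) (by simp [i_δ]) ≫ m = 𝟙 A₁
  m_δ : m ≫ δ = p₂ ≫ δ
  m_γ : m ≫ γ = p₁ ≫ γ
  /-- `m (1, m) = m (m, 1)` -/
  assoc : ∀ {T : C} (f g h : T ⟶ A₁) (hfg : f ≫ δ = g ≫ γ) (hgh : g ≫ δ = h ≫ γ),
    isPullback.lift f (isPullback.lift g h hgh ≫ m) (by simp [m_γ, hfg]) ≫ m =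
      isPullback.lift (isPullback.lift f g hfg ≫ m) h (by simp [m_δ, hgh]) ≫ m
  /-- There is an inversion `ι` with `m (ι, 1) = i δ` and `m (1, ι) = i γ`. -/
  exists_inv : ∃ (ι : A₁ ⟶ A₁) (hδ : ι ≫ δ = γ) (hγ : ι ≫ γ = δ),
    isPullback.lift ι (𝟙 A₁) (by simp [hδ]) ≫ m = δ ≫ i ∧
    isPullback.lift (𝟙 A₁) ι (by simp [hγ]) ≫ m = γ ≫ i

namespace InternalGroupoid

variable {C}

/-- An internal functor: a morphism of reflexive graphs that preserves the multiplication. -/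
@[ext]
structure Hom (G H : InternalGroupoid C) extends
    ReflexiveGraph.Hom G.toReflexiveGraph H.toReflexiveGraph where
  comm_m : G.m ≫ f₁ = H.isPullback.lift (G.p₁ ≫ f₁) (G.p₂ ≫ f₁)
    (by simp [comm_δ, comm_γ, reassoc_of% G.isPullback.w]) ≫ H.m

instance : Category (InternalGroupoid C) where
  Hom := Hom
  id G := ⟨𝟙 G.toReflexiveGraph, by
    have e : ∀ w, G.isPullback.lift (G.p₁ ≫ 𝟙 _) (G.p₂ ≫ 𝟙 _) w = 𝟙 _ := fun w =>
      G.isPullback.hom_ext (by simp) (by simp)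
    change G.m ≫ 𝟙 _ = G.isPullback.lift (G.p₁ ≫ 𝟙 _) (G.p₂ ≫ 𝟙 _) _ ≫ G.m
    rw [e]; simp⟩
  comp {G H L} f g := ⟨(show G.toReflexiveGraph ⟶ H.toReflexiveGraph from f.toHom) ≫
      (show H.toReflexiveGraph ⟶ L.toReflexiveGraph from g.toHom), by
    change G.m ≫ f.f₁ ≫ g.f₁ = L.isPullback.lift (G.p₁ ≫ f.f₁ ≫ g.f₁) (G.p₂ ≫ f.f₁ ≫ g.f₁) _ ≫ L.m
    rw [reassoc_of% f.comm_m, g.comm_m, ← Category.assoc]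
    congr 1
    exact L.isPullback.hom_ext (by simp) (by simp)⟩

/-- The underlying reflexive graph. -/
def forget : InternalGroupoid C ⥤ ReflexiveGraph C where
  obj G := G.toReflexiveGraph
  map f := f.toHom

end InternalGroupoid

end Internal

/-- The category of cocommutative Hopf algebras over `K`. -/
abbrev CocommHopf (K : Type u) [Field K] :=
  ObjectProperty.FullSubcategory fun H : HopfAlgCat.{v} K => IsCocomm K H

section Categories

variable (K : Type u) [Field K]

instance (H : CocommHopf.{u, v} K) : IsCocomm K H.obj := H.property

variable {K}

/-- The Hopf algebra morphism underlying a morphism of the category. -/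
abbrev toHom {X Y : CocommHopf.{u, v} K} (f : X ⟶ Y) : X.obj →ₐc[K] Y.obj := f.hom.toBialgHom

/-- Morphisms of the category from Hopf algebra morphisms. -/
abbrev ofHom {X Y : CocommHopf.{u, v} K} (f : X.obj →ₐc[K] Y.obj) : X ⟶ Y :=
  ObjectProperty.homMk ⟨f⟩

/-- Cocommutative Hopf algebras as objects of the category. -/
abbrev CocommHopf.of (X : Type v) [Ring X] [HopfAlgebra K X] [IsCocomm K X] : CocommHopf.{u, v} K :=
  ⟨HopfAlgCat.of K X, ‹_›⟩

theorem cocommHopf_ext {X Y : CocommHopf.{u, v} K} {f g : X ⟶ Y}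
    (h : ∀ x, toHom f x = toHom g x) : f = g :=
  ObjectProperty.hom_ext _ (HopfAlgCat.hom_ext _ _ (DFunLike.ext _ _ h))

variable (K)

/-- A cocommutative Hopf algebra `B`, a cocommutative `B`-module Hopf algebra `X` with action
`ᵇx = act b x`, and a Hopf algebra morphism `d : X → B`. -/
structure ModuleHopfMap where
  B : CocommHopf.{u, v} K
  X : CocommHopf.{u, v} K
  act : B.obj →ₗ[K] X.obj →ₗ[K] X.obj
  isModuleHopf : IsModuleHopf act
  d : X ⟶ B

namespace ModuleHopfMap

variable {K}

/-- A pair `(α, β)` with `d' α = β d` and `α(ᵇx) = ^{β(b)} α(x)`. -/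
@[ext]
structure Hom (M N : ModuleHopfMap.{u, v} K) where
  α : M.X ⟶ N.X
  β : M.B ⟶ N.B
  comm_d : α ≫ N.d = M.d ≫ β
  map_act : ∀ b x, toHom α (M.act b x) = N.act (toHom β b) (toHom α x)

instance : Category (ModuleHopfMap.{u, v} K) where
  Hom := Hom
  id M := ⟨𝟙 _, 𝟙 _, by simp, fun _ _ => rfl⟩
  comp f g := ⟨f.α ≫ g.α, f.β ≫ g.β, by simp [g.comm_d, reassoc_of% f.comm_d], fun b x =>
    (congrArg (toHom g.α) (f.map_act b x)).trans (g.map_act _ _)⟩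

/-- The two axioms of a Hopf crossed module, `d(ᵇx) = b₁ d(x) S(b₂)` and the Peiffer identity
`^{d(y)}x = y₁ x S(y₂)`. -/
structure IsCrossed (M : ModuleHopfMap.{u, v} K) : Prop where
  d_act : ∀ b x, toHom M.d (M.act b x) = ad K b (toHom M.d x)
  peiffer : ∀ y x, M.act (toHom M.d y) x = ad K y x

end ModuleHopfMap

/-- The category of Hopf crossed modules of cocommutative Hopf algebras. -/
abbrev HXMod := ObjectProperty.FullSubcategory (ModuleHopfMap.IsCrossed (K := K))

/-- The inclusion functor, forgetting the two axioms of a Hopf crossed module. -/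
abbrev HXMod.forget : HXMod.{u, v} K ⥤ ModuleHopfMap.{u, v} K := ObjectProperty.ι _

variable {K}

/-- For a reflexive graph `(δ, γ, i) : A₁ ⇉ A₀`, the morphism `d = γ ∘ hker δ : HKer δ → A₀`
with the conjugation action `ᵃk = i(a₁) k i(S(a₂))` of `A₀` on `HKer δ`. -/
noncomputable def kernelObj (G : ReflexiveGraph (CocommHopf.{u, v} K)) :
    ModuleHopfMap.{u, v} K where
  B := G.A₀
  X := CocommHopf.of (HKer (toHom G.δ))
  act := kerAct (toHom G.δ) (toHom G.i)
  isModuleHopf := kerAct_isModuleHopf _ _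
  d := ofHom (X := CocommHopf.of (HKer (toHom G.δ))) (hker (toHom G.δ)) ≫ G.γ

/-- The restriction of `f₁` to `HKer δ`, together with `f₀`. -/
noncomputable def kernelMap {G H : ReflexiveGraph (CocommHopf.{u, v} K)} (f : G ⟶ H) :
    kernelObj G ⟶ kernelObj H where
  α := ofHom (X := CocommHopf.of (HKer (toHom G.δ))) (Y := CocommHopf.of (HKer (toHom H.δ)))
    (hkerMap (toHom f.f₁) (toHom f.f₀) fun a => congr(toHom $f.comm_δ a))
  β := f.f₀
  comm_d := cocommHopf_ext fun (x : HKer (toHom G.δ)) =>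
    congr(toHom $f.comm_γ (x : G.A₁.obj))
  map_act b x := Subtype.ext <| by
    have e : toHom f.f₁ (toHom G.i b) = toHom H.i (toHom f.f₀ b) :=
      congr(toHom $f.comm_i.symm b)
    have e2 := ad_map (toHom f.f₁) (toHom G.i b) (Subtype.val x)
    rw [e] at e2
    exact e2

variable (K) in
/-- The functor sending a reflexive graph to its kernel `d = γ ∘ hker δ : HKer δ → A₀` with the
conjugation action. -/
noncomputable def kernelFunctor :
    ReflexiveGraph (CocommHopf.{u, v} K) ⥤ ModuleHopfMap.{u, v} K where
  obj := kernelObj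
  map := kernelMap
  map_id _ := ModuleHopfMap.Hom.ext (cocommHopf_ext fun _ => rfl) rfl
  map_comp _ _ := ModuleHopfMap.Hom.ext (cocommHopf_ext fun _ => rfl) rfl

/-- For a Hopf crossed module `d : X → B`, the reflexive graph `X ⋊ B ⇉ B`
with domain `p₂(x ⊗ b) = ε(x) b`, codomain `p₁(x ⊗ b) = d(x) b` and identities
`e(b) = 1 ⊗ b`. -/
noncomputable def smashObj (M : HXMod.{u, v} K) : ReflexiveGraph (CocommHopf.{u, v} K) where
  A₁ := CocommHopf.of (Smash M.obj.isModuleHopf)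
  A₀ := M.obj.B
  δ := ofHom (X := CocommHopf.of (Smash M.obj.isModuleHopf)) (smashDom M.obj.isModuleHopf)
  γ := ofHom (X := CocommHopf.of (Smash M.obj.isModuleHopf))
    (smashCod M.obj.isModuleHopf (toHom M.obj.d) M.property.d_act)
  i := ofHom (Y := CocommHopf.of (Smash M.obj.isModuleHopf)) (smashUnit M.obj.isModuleHopf)
  i_δ := cocommHopf_ext fun b => by
    change counit (R := K) (1 : M.obj.X.obj) • b = b
    simp
  i_γ := cocommHopf_ext fun b => by
    change toHom M.obj.d 1 * b = b
    simp

theorem smash_ext {A B D : Type v} [Ring A] [HopfAlgebra K A] [Ring B] [HopfAlgebra K B]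
    [IsCocomm K A] [IsCocomm K B] [Ring D] [HopfAlgebra K D] {ξ : B →ₗ[K] A →ₗ[K] A}
    (h : IsModuleHopf ξ) {f g : Smash h →ₐc[K] D}
    (hfg : ∀ (a : A) (b : B), f (a ⊗ₜ[K] b : A ⊗[K] B) = g (a ⊗ₜ[K] b : A ⊗[K] B)) (x : Smash h) :
    f x = g x := by
  have e : (f : Smash h →ₗ[K] D) = (g : Smash h →ₗ[K] D) :=
    TensorProduct.ext' (M := A) (N := B) hfg
  exact congr($e x)

/-- The morphism of reflexive graphs given by `α ⊗ β` and `β`. -/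
noncomputable def smashGraphMap {M N : HXMod.{u, v} K} (f : M ⟶ N) : smashObj M ⟶ smashObj N where
  f₁ := ofHom (X := CocommHopf.of (Smash M.obj.isModuleHopf))
    (Y := CocommHopf.of (Smash N.obj.isModuleHopf))
    (smashMap _ _ (toHom f.hom.α) (toHom f.hom.β) f.hom.map_act)
  f₀ := f.hom.β
  comm_δ := cocommHopf_ext <| smash_ext M.obj.isModuleHopf fun x b => by
    change counit (R := K) (toHom f.hom.α x) • toHom f.hom.β b =
      toHom f.hom.β (counit (R := K) x • b)
    simp
  comm_γ := cocommHopf_ext <| smash_ext M.obj.isModuleHopf fun x b => by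
    change toHom N.obj.d (toHom f.hom.α x) * toHom f.hom.β b =
      toHom f.hom.β (toHom M.obj.d x * b)
    have e : toHom N.obj.d (toHom f.hom.α x) = toHom f.hom.β (toHom M.obj.d x) :=
      congr(toHom $f.hom.comm_d x)
    rw [map_mul, e]
  comm_i := cocommHopf_ext fun b => by
    change (1 : N.obj.X.obj) ⊗ₜ[K] toHom f.hom.β b = toHom f.hom.α 1 ⊗ₜ[K] toHom f.hom.β b
    rw [map_one]

variable (K) in
/-- The functor sending a Hopf crossed module `d : X → B` to the smash product graph
`X ⋊ B ⇉ B`. -/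
noncomputable def smashFunctor : HXMod.{u, v} K ⥤ ReflexiveGraph (CocommHopf.{u, v} K) where
  obj := smashObj
  map := smashGraphMap
  map_id M := ReflexiveGraph.Hom.ext
    (cocommHopf_ext <| smash_ext M.obj.isModuleHopf fun _ _ => rfl) rfl
  map_comp {M _ _} _ _ := ReflexiveGraph.Hom.ext
    (cocommHopf_ext <| smash_ext M.obj.isModuleHopf fun _ _ => rfl) rfl

/-- `(x ⊗ b) ⊗ (x' ⊗ b') ↦ x x' ⊗ ε(b) b'`, the composition of the arrows `x ⊗ b` and `x' ⊗ b'`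
of `X ⋊ B` when these are composable. -/
noncomputable def smashComp (M : HXMod.{u, v} K) :
    (smashObj M).A₁.obj ⊗[K] (smashObj M).A₁.obj →ₗ[K] (smashObj M).A₁.obj :=
  TensorProduct.map (LinearMap.mul' K M.obj.X.obj)
      ((TensorProduct.lid K M.obj.B.obj).toLinearMap ∘ₗ
        LinearMap.rTensor M.obj.B.obj (counit (R := K) (A := M.obj.B.obj))) ∘ₗ
    (TensorProduct.tensorTensorTensorComm K M.obj.X.obj M.obj.B.obj
      M.obj.X.obj M.obj.B.obj).toLinearMap

end Categories

end HopfXMod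

open HopfXMod

/-!
Cocommutative Hopf algebras are the group objects among cocommutative coalgebras: for a
cocommutative coalgebra `C` and a cocommutative Hopf algebra `A`, the coalgebra morphisms `C → A`
form a group under convolution. The equivalence between internal groupoids and crossed modules of
groups can therefore be transported to this setting, with identities between group elements
replaced by identities in the convolution algebras `WithConv (C →ₗ[K] A)`. The subobjects and
extensions involved have to be found as Hopf algebras, and two universal properties of the smash
product `X ⋊ B` provide them.

* A Hopf algebra morphism `T → X ⋊ B` is a morphism `v : T → B` together with a crossed
  homomorphism `T → X` along `v` (`smashPair`, `smash_coalgHom_ext`). Hence `X ⋊ B'`, with the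
  action restricted along `B' → B`, is the pullback of `p₂ : X ⋊ B → B` along `B' → B`
  (`smashBaseLift`, `smash_isPullback`). In particular `X ⋊ (X ⋊ B)` is the object of composable
  pairs of the graph `X ⋊ B ⇉ B`.
* A morphism `X ⋊ B → D` is a pair of morphisms `X → D` and `B → D` that turn the action into
  conjugation (`smashDesc`, `smash_hom_ext`). For the identity of `X ⋊ B` and the inclusion of `X`
  this compatibility is the Peiffer identity (`smashInlHom_act_smashCod`), and the resulting
  morphism `X ⋊ (X ⋊ B) → X ⋊ B` is the groupoid composition.

In the convolution algebra this composition is `(f, g) ↦ f (1_{δ f})⁻¹ g` (`toConv_lift_comp`),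
where `f (1_{δ f})⁻¹` is the `X`-component of `f`. Associativity, the inverse laws and the explicit
formula `m(x ⊗ b, x' ⊗ b') = x x' ⊗ ε(b) b'` all follow from this.

Conversely, let `G` be an internal groupoid. Composable pairs in which one arrow is an identity
generate, and on these the multiplication is prescribed by the unit laws. This gives both the
Peiffer identity on `HKer δ` (`ad_i_γ`) and the fact that every morphism of reflexive graphs from
a smash product groupoid to `G` preserves the multiplication (`smashGroupoidHom`).

The unit of the equivalence is the isomorphism `HKer δ ⋊ A₀ ≅ A₁`, `k ⊗ b ↦ k i(b)`, whose inverse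
is `a ↦ a₁ i(δ(S(a₂))) ⊗ δ(a₃)` (`kerSmashEquiv`). The counit is the identification of `X` with
the Hopf kernel of `p₂ : X ⋊ B → B` (`smashKerEquiv`).
-/

namespace HopfXMod

/-! ### Coalgebra morphisms and Hopf kernels -/

section CoalgebraMaps

variable {K : Type u} [Field K] {A B : Type v} [Ring A] [HopfAlgebra K A]
  [Ring B] [HopfAlgebra K B]
  {C : Type w} [AddCommGroup C] [Module K C] [Coalgebra K C]

/-- The antipode of a cocommutative Hopf algebra is a coalgebra morphism. -/
noncomputable def antipodeCoalgHom (K : Type u) [Field K] (A : Type v) [Ring A] [HopfAlgebra K A]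
    [IsCocomm K A] : A →ₗc[K] A where
  __ := antipode K (A := A)
  counit_comp := counit_comp_antipode
  map_comp_comul := by
    ext a
    have h := map_antipode (comulBialgHom K A) a
    rw [TensorProduct.antipode_def] at h
    exact h.symm

/-- A coalgebra morphism that `f` trivializes takes values in the Hopf kernel of `f`. -/
theorem mem_HKer_of_comp_eq_counit (f : A →ₐc[K] B) (g : C →ₗc[K] A)
    (hg : ∀ c, f (g c) = algebraMap K B (counit c)) (c : C) : g c ∈ HKer f := by
  rw [mem_HKer, ← CoalgHomClass.map_comp_comul_apply]
  conv_rhs => rw [← sum_counit_smul (ℛ K c)]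
  rw [← (ℛ K c).eq]
  simp [hg, TensorProduct.tmul_sum, Algebra.algebraMap_eq_smul_one, TensorProduct.smul_tmul]

theorem apply_of_mem_HKer (f : A →ₐc[K] B) {a : A} (ha : a ∈ HKer f) :
    f a = algebraMap K B (counit a) := by
  rw [mem_HKer] at ha
  have e := congr(TensorProduct.rid K B ((counit (R := K)).lTensor B $ha))
  rw [← (ℛ K a).eq] at e
  simpa [Algebra.algebraMap_eq_smul_one] using e

variable [IsCocomm K A]

/-- The factorization through `HKer f` of a coalgebra morphism that `f` trivializes. -/
noncomputable def hkerLiftCoalg (f : A →ₐc[K] B) (g : C →ₗc[K] A)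
    (hg : ∀ c, f (g c) = algebraMap K B (counit c)) : C →ₗc[K] HKer f where
  __ := LinearMap.codRestrict (Subalgebra.toSubmodule (HKer f)) g.toLinearMap
    (mem_HKer_of_comp_eq_counit f g hg)
  counit_comp := g.counit_comp
  map_comp_comul := by
    ext c
    apply hker_map_injective f
    refine Eq.trans ?_ (map_hkerComul f _).symm
    refine Eq.trans ?_ (CoalgHomClass.map_comp_comul_apply g c)
    simp only [LinearMap.comp_apply]
    generalize comul (R := K) c = z
    induction z with
    | zero => simp
    | add x y hx hy => simp only [map_add, hx, hy]
    | tmul x y => rfl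

/-- The factorization through `HKer f` of a Hopf algebra morphism that `f` trivializes. -/
noncomputable def hkerLift {T : Type v} [Ring T] [HopfAlgebra K T] (f : A →ₐc[K] B)
    (g : T →ₐc[K] A) (hg : ∀ t, f (g t) = algebraMap K B (counit t)) : T →ₐc[K] HKer f where
  __ := hkerLiftCoalg f (g : T →ₗc[K] A) hg
  map_one' := Subtype.ext (map_one g)
  map_mul' x y := Subtype.ext (map_mul g x y)

/-- For a section `i` of `f`, the coalgebra morphism `a ↦ a₁ i(f(S(a₂)))`, the analogue of the
retraction of a split extension of groups onto its kernel. -/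
noncomputable def kerProj (f : A →ₐc[K] B) (i : B →ₐc[K] A) : A →ₗc[K] A :=
  ((mulCoalgHom K A).comp (Coalgebra.TensorProduct.map (CoalgHom.id K A)
    ((antipodeCoalgHom K A).comp (i.comp f : A →ₗc[K] A)))).comp (comulCoalgHom K A)

theorem toConv_kerProj (f : A →ₐc[K] B) (i : B →ₐc[K] A) :
    toConv (kerProj f i).toLinearMap =
      toConv LinearMap.id * toConv (antipode K ∘ₗ ((i.comp f : A →ₗc[K] A)).toLinearMap) := rfl

theorem apply_kerProj (f : A →ₐc[K] B) (i : B →ₐc[K] A) (hi : ∀ b, f (i b) = b) (a : A) :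
    f (kerProj f i a) = algebraMap K B (counit a) := by
  have h := LinearMap.algHom_comp_convMul_distrib (f : A →ₐ[K] B) (toConv LinearMap.id)
    (toConv (antipode K ∘ₗ ((i.comp f : A →ₗc[K] A)).toLinearMap))
  have e : (f : A →ₐ[K] B).toLinearMap ∘ₗ antipode K ∘ₗ ((i.comp f : A →ₗc[K] A)).toLinearMap =
      antipode K ∘ₗ (f : A →ₗc[K] B).toLinearMap := by
    ext a
    exact (map_antipode f (i (f a))).trans congr(antipode K $(hi (f a)))
  have h2 := antipode_conv_right (f : A →ₗc[K] B)
  rw [← e] at h2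
  exact congr($(h.trans congr(ofConv $h2)) a)

end CoalgebraMaps

/-! ### Morphisms into and out of a smash product -/

section SmashMaps

variable {K : Type u} [Field K] {A B D T : Type v} [Ring A] [HopfAlgebra K A]
  [Ring B] [HopfAlgebra K B] [Ring D] [HopfAlgebra K D] [Ring T] [HopfAlgebra K T]
  {ξ : B →ₗ[K] A →ₗ[K] A} (h : IsModuleHopf ξ)
  {C : Type w} [AddCommGroup C] [Module K C] [Coalgebra K C]

theorem smashFst_tmul (a : A) (b : B) :
    smashFst h (a ⊗ₜ[K] b : A ⊗[K] B) = counit (R := K) b • a := rfl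

theorem smashSnd_tmul (a : A) (b : B) :
    smashSnd h (a ⊗ₜ[K] b : A ⊗[K] B) = counit (R := K) a • b := rfl

theorem smashInl_mul_smashInr (a : A) (b : B) :
    smashInl h a * smashInr h b = (a ⊗ₜ[K] b : A ⊗[K] B) := by
  change smashMul ξ (a ⊗ₜ 1) (1 ⊗ₜ b) = _
  rw [smashMul_tmul, twist_one h, mulL_tmul, mul_one]

/-- Coalgebra morphisms into `A ⋊ B` are determined by their two components, since
`w = fst(w₁) ⊗ snd(w₂)`. -/
theorem smash_coalgHom_ext {g g' : C →ₗc[K] Smash h}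
    (h1 : ∀ c, smashFst h (g c) = smashFst h (g' c))
    (h2 : ∀ c, smashSnd h (g c) = smashSnd h (g' c)) (c : C) : g c = g' c := by
  have key : ∀ g : C →ₗc[K] Smash h, toConv g.toLinearMap =
      toConv ((smashInl h).toLinearMap ∘ₗ (smashFst h).toLinearMap ∘ₗ g.toLinearMap) *
      toConv ((smashInr h).toLinearMap ∘ₗ (smashSnd h).toLinearMap ∘ₗ g.toLinearMap) := by
    intro g
    have e := LinearMap.convMul_comp_coalgHom_distrib
      (toConv ((smashInl h).toLinearMap ∘ₗ (smashFst h).toLinearMap))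
      (toConv ((smashInr h).toLinearMap ∘ₗ (smashSnd h).toLinearMap)) g
    rw [← smash_id_eq h] at e
    exact congr(toConv $e)
  have e1 : (smashFst h).toLinearMap ∘ₗ g.toLinearMap =
    (smashFst h).toLinearMap ∘ₗ g'.toLinearMap := LinearMap.ext h1
  have e2 : (smashSnd h).toLinearMap ∘ₗ g.toLinearMap =
    (smashSnd h).toLinearMap ∘ₗ g'.toLinearMap := LinearMap.ext h2
  have e : toConv g.toLinearMap = toConv g'.toLinearMap := by
    rw [key g, key g', e1, e2]
  exact congr($e c)

/-- The coalgebra morphism `c ↦ j(c₁) ⊗ v(c₂)` with components `j` and `v`. -/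
noncomputable def smashPairCoalg [IsCocomm K C] (j : C →ₗc[K] A) (v : C →ₗc[K] B) :
    C →ₗc[K] Smash h :=
  (Coalgebra.TensorProduct.map j v).comp (comulCoalgHom K C)

theorem smashPairCoalg_apply [IsCocomm K C] (j : C →ₗc[K] A) (v : C →ₗc[K] B) {ι : Type*} {c : C}
    (r : Coalgebra.Repr K c ι) : smashPairCoalg h j v c =
      ∑ k ∈ r.index, (j (r.left k) ⊗ₜ[K] v (r.right k) : A ⊗[K] B) := by
  change TensorProduct.map j.toLinearMap v.toLinearMap (comul c) = _
  rw [← r.eq, map_sum]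
  rfl

theorem smashFst_smashPairCoalg [IsCocomm K C] (j : C →ₗc[K] A) (v : C →ₗc[K] B) (c : C) :
    smashFst h (smashPairCoalg h j v c) = j c := by
  rw [smashPairCoalg_apply h j v (ℛ K c)]
  refine (map_sum (smashFst h).toLinearMap _ _).trans ?_
  conv_rhs => rw [← sum_counit_smul_left (ℛ K c), map_sum]
  refine Finset.sum_congr rfl fun k _ => (smashFst_tmul h _ _).trans ?_
  rw [map_smul, CoalgHomClass.counit_comp_apply]

theorem smashSnd_smashPairCoalg [IsCocomm K C] (j : C →ₗc[K] A) (v : C →ₗc[K] B) (c : C) :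
    smashSnd h (smashPairCoalg h j v c) = v c := by
  rw [smashPairCoalg_apply h j v (ℛ K c)]
  refine (map_sum (smashSnd h).toLinearMap _ _).trans ?_
  conv_rhs => rw [← sum_counit_smul (ℛ K c), map_sum]
  refine Finset.sum_congr rfl fun k _ => (smashSnd_tmul h _ _).trans ?_
  rw [map_smul, CoalgHomClass.counit_comp_apply]

/-- The linear action of `A ⋊ B` on `A`, `(x ⊗ b) · a = x (ᵇa)`. -/
noncomputable def smashAct : Smash h →ₗ[K] A →ₗ[K] A :=
  TensorProduct.lift ((LinearMap.llcomp K A A A ∘ₗ LinearMap.mul K A).compl₂ ξ)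

/-- The projection `fst` is a crossed homomorphism along `snd`. -/
theorem smashFst_mul (u w : Smash h) : smashFst h (u * w) = smashAct h u (smashFst h w) := by
  let F : A ⊗[K] B →ₗ[K] A := (smashFst h).toLinearMap
  let G : A ⊗[K] B →ₗ[K] A →ₗ[K] A := smashAct h
  have key : ∀ u w : A ⊗[K] B, F (smashMul ξ u w) = G u (F w) := by
    intro u w
    induction u with
    | zero => simp
    | add x y hx hy => simp only [map_add, LinearMap.add_apply, hx, hy]
    | tmul x b =>
    induction w with
    | zero => simp
    | add x y hx hy => simp only [map_add, hx, hy]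
    | tmul a c =>
      have hF : ∀ a b, F (a ⊗ₜ b) = counit (R := K) b • a := smashFst_tmul h
      have hG : G (x ⊗ₜ b) (counit (R := K) c • a) = x * ξ b (counit (R := K) c • a) := rfl
      rw [smashMul_tmul_tmul (ℛ K b), hF, hG]
      conv_rhs => rw [← sum_counit_smul_left (ℛ K b)]
      simp [hF, Finset.mul_sum, Finset.smul_sum, smul_smul, mul_comm]
  exact key u w

/-- The morphism `A ⋊ B → D`, `a ⊗ b ↦ α(a) β(b)`, induced by morphisms `α` and `β` that are
compatible with the action and with conjugation in `D`. -/
noncomputable def smashDesc (α : A →ₐc[K] D) (β : B →ₐc[K] D)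
    (hc : ∀ b a, α (ξ b a) = ad K (β b) (α a)) : Smash h →ₐc[K] D :=
  smashLift h ((mulCoalgHom K D).comp
    (Coalgebra.TensorProduct.map (α : A →ₗc[K] D) (β : B →ₗc[K] D)))
    (by simp) (by
      intro a b a' b'
      rw [smashMul_tmul_tmul (ℛ K b)]
      have e := sum_ad_mul ((ℛ K b).induced β) (α a')
      simp only [CoalgHom.comp_apply, map_sum, Coalgebra.TensorProduct.map_tmul, mul_assoc,
        coe_mulCoalgHom, LinearMap.mul'_apply]
      simp only [BialgHom.coe_toCoalgHom, map_mul, hc]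
      rw [← mul_assoc (β b), ← e]
      simp [Finset.sum_mul, Finset.mul_sum, mul_assoc])

theorem smashDesc_tmul (α : A →ₐc[K] D) (β : B →ₐc[K] D)
    (hc : ∀ b a, α (ξ b a) = ad K (β b) (α a)) (a : A) (b : B) :
    smashDesc h α β hc (a ⊗ₜ[K] b : A ⊗[K] B) = α a * β b := rfl

/-- The inclusion `a ↦ a ⊗ 1`, as a morphism of Hopf algebras. -/
noncomputable def smashInlHom : A →ₐc[K] Smash h :=
  { smashInl h with
    map_smul' := map_smul (smashInl h)
    counit_comp := by
      ext a
      change counit (R := K) (a ⊗ₜ[K] (1 : B)) = _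
      simp
    map_comp_comul := by
      ext a
      change TensorProduct.map ((TensorProduct.mk K A B).flip 1) ((TensorProduct.mk K A B).flip 1)
        (comul (R := K) a) = comul (R := K) (a ⊗ₜ[K] (1 : B))
      rw [TensorProduct.comul_tmul, Bialgebra.comul_one]
      generalize comul (R := K) a = z
      induction z with
      | zero => simp
      | add x y hx hy => simp only [map_add, TensorProduct.add_tmul, hx, hy]
      | tmul x y => rfl }

theorem smashFst_smashInlHom (a : A) : smashFst h (smashInlHom h a) = a := by
  refine (smashFst_tmul h a 1).trans ?_
  rw [counit_one, one_smul]

section Desc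

variable (α : A →ₐc[K] D) (β : B →ₐc[K] D) (hc : ∀ b a, α (ξ b a) = ad K (β b) (α a))

theorem smashDesc_inl (a : A) : smashDesc h α β hc (smashInlHom h a) = α a := by
  refine (smashDesc_tmul h α β hc a 1).trans ?_
  rw [map_one, mul_one]

theorem smashDesc_inr (b : B) : smashDesc h α β hc (smashUnit h b) = β b := by
  refine (smashDesc_tmul h α β hc 1 b).trans ?_
  rw [map_one, one_mul]

end Desc

theorem toConv_smashDesc (α : A →ₐc[K] D) (β : B →ₐc[K] D)
    (hc : ∀ b a, α (ξ b a) = ad K (β b) (α a)) :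
    toConv ((smashDesc h α β hc : Smash h →ₗc[K] D)).toLinearMap =
      toConv ((α : A →ₗc[K] D).toLinearMap ∘ₗ (smashFst h).toLinearMap) *
      toConv ((β : B →ₗc[K] D).toLinearMap ∘ₗ (smashSnd h).toLinearMap) := by
  have e := LinearMap.algHom_comp_convMul_distrib (smashDesc h α β hc : Smash h →ₐ[K] D)
    (toConv ((smashInl h).toLinearMap ∘ₗ (smashFst h).toLinearMap))
    (toConv ((smashInr h).toLinearMap ∘ₗ (smashSnd h).toLinearMap))
  rw [← smash_id_eq h] at e
  have e1 : (smashDesc h α β hc : Smash h →ₐ[K] D).toLinearMap ∘ₗ (smashInl h).toLinearMap =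
      (α : A →ₗc[K] D).toLinearMap := LinearMap.ext (smashDesc_inl h α β hc)
  have e2 : (smashDesc h α β hc : Smash h →ₐ[K] D).toLinearMap ∘ₗ (smashInr h).toLinearMap =
      (β : B →ₗc[K] D).toLinearMap := LinearMap.ext (smashDesc_inr h α β hc)
  rw [← e1, ← e2]
  exact congr(toConv $e)

variable [IsCocomm K A] [IsCocomm K B]

theorem smash_hom_ext {f g : Smash h →ₐc[K] D}
    (h1 : ∀ a, f (smashInlHom h a) = g (smashInlHom h a))
    (h2 : ∀ b, f (smashUnit h b) = g (smashUnit h b)) (x : Smash h) : f x = g x :=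
  smash_ext h (fun a b => by
    rw [← smashInl_mul_smashInr h a b, map_mul, map_mul]
    exact congr($(h1 a) * $(h2 b))) x

/-- A crossed homomorphism `j : T → A` along `v : T → B` gives a morphism `T → A ⋊ B`. The
condition `j(tt') = j(t₁) (^{v(t₂)} j(t'))` is expressed through the action of
`j(t₁) ⊗ v(t₂)` on `A`. -/
noncomputable def smashPair [IsCocomm K T] (j : T →ₗc[K] A) (v : T →ₐc[K] B) (h1 : j 1 = 1)
    (hm : ∀ t t', j (t * t') = smashAct h (smashPairCoalg h j (v : T →ₗc[K] B) t) (j t')) :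
    T →ₐc[K] Smash h where
  __ := smashPairCoalg h j (v : T →ₗc[K] B)
  map_one' := by
    change TensorProduct.map j.toLinearMap (v : T →ₗc[K] B).toLinearMap (comul (R := K) 1) = _
    rw [Bialgebra.comul_one]
    change j 1 ⊗ₜ[K] v 1 = (1 ⊗ₜ[K] 1 : A ⊗[K] B)
    rw [h1, map_one]
  -- Both sides are coalgebra morphisms on `T ⊗ T`, so it suffices to compare components.
  map_mul' x y := by
    have e := smash_coalgHom_ext h
      (g := (smashPairCoalg h j (v : T →ₗc[K] B)).comp (mulCoalgHom K T))
      (g' := (mulCoalgHom K (Smash h)).comp (Coalgebra.TensorProduct.map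
        (smashPairCoalg h j (v : T →ₗc[K] B)) (smashPairCoalg h j (v : T →ₗc[K] B))))
    refine e ?_ ?_ (x ⊗ₜ y)
    · intro c
      induction c with
      | zero => simp
      | add c c' hc hc' => simp only [map_add, hc, hc']
      | tmul t t' =>
        refine (smashFst_smashPairCoalg h j _ _).trans ((hm t t').trans ?_)
        refine Eq.trans ?_ (smashFst_mul h _ _).symm
        exact congr(smashAct h _ $(smashFst_smashPairCoalg h j _ _)).symm
    · intro c
      induction c with
      | zero => simp
      | add c c' hc hc' => simp only [map_add, hc, hc']
      | tmul t t' =>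
        refine (smashSnd_smashPairCoalg h j _ _).trans ((map_mul v t t').trans ?_)
        refine Eq.trans ?_ (map_mul (smashDom h) _ _).symm
        exact congr($(smashSnd_smashPairCoalg h j _ _) * $(smashSnd_smashPairCoalg h j _ _)).symm

/-- In `A ⋊ B`, conjugation by `1 ⊗ b` restricts to the action of `b` on `A`. -/
theorem ad_smashUnit_smashInlHom (b : B) (a : A) :
    ad K (smashUnit h b) (smashInlHom h a) = smashInlHom h (ξ b a) := by
  let U : B →ₗ[K] Smash h := (smashInr h).toLinearMap
  have hU : toConv U * toConv (antipode K ∘ₗ U) = 1 :=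
    antipode_conv_right (smashUnit h : B →ₗc[K] Smash h)
  have h1 : toConv (LinearMap.mulRight K (smashInl h a) ∘ₗ U) =
      toConv ((smashInl h).toLinearMap ∘ₗ ξ.flip a) * toConv U := by
    ext b
    rw [(ℛ K b).convMul_apply]
    refine Eq.trans ?_ (Finset.sum_congr rfl fun k _ => (smashInl_mul_smashInr h _ _).symm)
    change smashMul ξ (1 ⊗ₜ b) (a ⊗ₜ 1) = _
    rw [smashMul_tmul_tmul (ℛ K b)]
    simp
    rfl
  have h2 : toConv (((ad K).toLinearMap.flip (smashInl h a)) ∘ₗ U) =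
      toConv (LinearMap.mulRight K (smashInl h a) ∘ₗ U) * toConv (antipode K ∘ₗ U) := by
    ext b
    rw [(ℛ K b).convMul_apply]
    exact ad_repr ((ℛ K b).induced (smashUnit h)) _
  rw [h1, mul_assoc, hU, mul_one] at h2
  exact congr($h2 b)

theorem ad_smashInlHom (a x : A) :
    ad K (smashInlHom h a) (smashInlHom h x) = smashInlHom h (ad K a x) :=
  (ad_map (smashInlHom h) a x).symm

end SmashMaps

/-! ### Split projections as smash products -/

section KernelDecomposition

variable {K : Type u} [Field K] {A B : Type v} [Ring A] [HopfAlgebra K A]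
  [Ring B] [HopfAlgebra K B] [IsCocomm K A] [IsCocomm K B]
  (f : A →ₐc[K] B) (i : B →ₐc[K] A)

/-- The comparison `HKer f ⋊ B → A`, `k ⊗ b ↦ k i(b)`. -/
noncomputable def kerSmashHom : Smash (kerAct_isModuleHopf f i) →ₐc[K] A :=
  smashDesc _ (hker f) i fun b k => coe_kerAct f i b k

variable (hi : ∀ b, f (i b) = b)

include hi in
theorem apply_kerSmashHom (w : Smash (kerAct_isModuleHopf f i)) :
    f (kerSmashHom f i w) = smashSnd _ w := by
  refine smash_hom_ext (kerAct_isModuleHopf f i) (f := f.comp (kerSmashHom f i))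
    (g := smashDom _) (fun k => ?_) (fun b => ?_) w
  · change f (kerSmashHom f i (smashInlHom _ k)) = _
    refine (congrArg f (smashDesc_inl _ _ _ _ k)).trans ((apply_of_mem_HKer f k.2).trans ?_)
    exact Algebra.algebraMap_eq_smul_one _
  · change f (kerSmashHom f i (smashUnit _ b)) = _
    refine (congrArg f (smashDesc_inr _ _ _ _ b)).trans ((hi b).trans ?_)
    change b = counit (R := K) (1 : HKer f) • b
    rw [counit_one, one_smul]

/-- The inverse of the comparison, `a ↦ a₁ i(f(S(a₂))) ⊗ f(a₃)`. -/
noncomputable def kerSmashInv : A →ₗc[K] Smash (kerAct_isModuleHopf f i) :=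
  smashPairCoalg _ (hkerLiftCoalg f (kerProj f i) (apply_kerProj f i hi)) (f : A →ₗc[K] B)

omit [IsCocomm K B] in
theorem kerSmashHom_kerSmashInv (a : A) : kerSmashHom f i (kerSmashInv f i hi a) = a := by
  have e := LinearMap.convMul_comp_coalgHom_distrib
    (toConv ((hker f : HKer f →ₗc[K] A).toLinearMap ∘ₗ
      (smashFst (kerAct_isModuleHopf f i)).toLinearMap))
    (toConv ((i : B →ₗc[K] A).toLinearMap ∘ₗ
      (smashSnd (kerAct_isModuleHopf f i)).toLinearMap)) (kerSmashInv f i hi)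
  rw [← toConv_smashDesc (kerAct_isModuleHopf f i) (hker f) i fun b k => coe_kerAct f i b k] at e
  have e1 : ((hker f : HKer f →ₗc[K] A).toLinearMap ∘ₗ
      (smashFst (kerAct_isModuleHopf f i)).toLinearMap) ∘ₗ (kerSmashInv f i hi).toLinearMap =
      (kerProj f i).toLinearMap :=
    LinearMap.ext fun a => congrArg Subtype.val (smashFst_smashPairCoalg _ _ _ a)
  have e2 : ((i : B →ₗc[K] A).toLinearMap ∘ₗ
      (smashSnd (kerAct_isModuleHopf f i)).toLinearMap) ∘ₗ (kerSmashInv f i hi).toLinearMap =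
      (i.comp f : A →ₗc[K] A).toLinearMap :=
    LinearMap.ext fun a => congrArg i (smashSnd_smashPairCoalg _ _ _ a)
  dsimp only at e
  rw [e1, e2, toConv_kerProj, mul_assoc, antipode_conv_left, mul_one] at e
  exact congr($e a)

theorem kerSmashInv_kerSmashHom (w : Smash (kerAct_isModuleHopf f i)) :
    kerSmashInv f i hi (kerSmashHom f i w) = w := by
  refine smash_coalgHom_ext _
    (g := (kerSmashInv f i hi).comp (kerSmashHom f i : Smash (kerAct_isModuleHopf f i) →ₗc[K] A))
    (g' := CoalgHom.id K _) (fun w => ?_) (fun w => ?_) w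
  · refine (smashFst_smashPairCoalg _ _ _ _).trans (Subtype.ext ?_)
    -- Precomposed with the comparison, `kerProj` is `(fst) (i ∘ snd) (S ∘ i ∘ snd) = fst`.
    have e := LinearMap.convMul_comp_coalgHom_distrib (toConv LinearMap.id)
      (toConv (antipode K ∘ₗ ((i.comp f : A →ₗc[K] A)).toLinearMap))
      (kerSmashHom f i : Smash (kerAct_isModuleHopf f i) →ₗc[K] A)
    rw [← toConv_kerProj] at e
    have e1 : (antipode K ∘ₗ ((i.comp f : A →ₗc[K] A)).toLinearMap) ∘ₗ
        (kerSmashHom f i : Smash (kerAct_isModuleHopf f i) →ₗc[K] A).toLinearMap =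
        antipode K ∘ₗ ((i : B →ₗc[K] A).comp (smashSnd (kerAct_isModuleHopf f i))).toLinearMap :=
      LinearMap.ext fun a => congr(antipode K (i $(apply_kerSmashHom f i hi a)))
    have e2 : toConv (kerSmashHom f i : Smash (kerAct_isModuleHopf f i) →ₗc[K] A).toLinearMap = _ :=
      toConv_smashDesc (kerAct_isModuleHopf f i) (hker f) i fun b k => coe_kerAct f i b k
    dsimp only at e
    rw [e1, LinearMap.id_comp, e2, mul_assoc] at e
    have e3 := antipode_conv_right ((i : B →ₗc[K] A).comp (smashSnd (kerAct_isModuleHopf f i)))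
    change toConv ((i : B →ₗc[K] A).toLinearMap ∘ₗ
      (smashSnd (kerAct_isModuleHopf f i)).toLinearMap) * _ = 1 at e3
    rw [e3, mul_one] at e
    exact congr($e w)
  · exact (smashSnd_smashPairCoalg _ _ _ _).trans (apply_kerSmashHom f i hi w)

/-- A cocommutative Hopf algebra `A` with a split projection `f` is the smash product
`HKer f ⋊ B`. -/
noncomputable def kerSmashEquiv : Smash (kerAct_isModuleHopf f i) ≃ₐc[K] A :=
  BialgEquiv.ofBijective (kerSmashHom f i)
    ⟨Function.LeftInverse.injective (kerSmashInv_kerSmashHom f i hi),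
      Function.RightInverse.surjective (kerSmashHom_kerSmashInv f i hi)⟩

end KernelDecomposition

/-! ### The Hopf kernel of `p₂` -/

section SmashKernel

variable {K : Type u} [Field K] {A B : Type v} [Ring A] [HopfAlgebra K A]
  [Ring B] [HopfAlgebra K B] [IsCocomm K A] [IsCocomm K B] {ξ : B →ₗ[K] A →ₗ[K] A}
  (h : IsModuleHopf ξ)

/-- The inclusion `a ↦ a ⊗ 1` of `A` into the Hopf kernel of `p₂ : A ⋊ B → B`. -/
noncomputable def smashKerHom : A →ₐc[K] HKer (smashDom h) :=
  hkerLift (smashDom h) (smashInlHom h) fun a =>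
    (Algebra.algebraMap_eq_smul_one (A := B) (counit (R := K) a)).symm

theorem smashKerHom_bijective : Function.Bijective (smashKerHom h) := by
  refine ⟨fun a a' e => ?_, fun k => ⟨smashFst h (k : Smash h), Subtype.ext ?_⟩⟩
  · rw [← smashFst_smashInlHom h a, ← smashFst_smashInlHom h a']
    exact congr(smashFst h (Subtype.val $e))
  · have hs : ∀ k : HKer (smashDom h), smashSnd h (k : Smash h) =
        algebraMap K B (counit (R := K) (k : Smash h)) := fun k =>
      apply_of_mem_HKer (smashDom h) k.2
    refine smash_coalgHom_ext h
      (g := (smashInlHom h : A →ₗc[K] Smash h).comp ((smashFst h).comp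
        (hker (smashDom h) : _ →ₗc[K] Smash h)))
      (g' := (hker (smashDom h) : _ →ₗc[K] Smash h)) (fun k => ?_) (fun k => ?_) k
    · exact smashFst_smashInlHom h _
    · refine Eq.trans ?_ (hs k).symm
      refine (smashSnd_tmul h _ _).trans ?_
      rw [Algebra.algebraMap_eq_smul_one]
      congr 1
      exact CoalgHomClass.counit_comp_apply (smashFst h) _

/-- `A` is the Hopf kernel of `p₂ : A ⋊ B → B`. -/
noncomputable def smashKerEquiv : A ≃ₐc[K] HKer (smashDom h) :=
  BialgEquiv.ofBijective (smashKerHom h) (smashKerHom_bijective h)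

end SmashKernel

/-! ### Pullbacks of `p₂` -/

section BaseChange

variable {K : Type u} [Field K] {A B B' T : Type v} [Ring A] [HopfAlgebra K A]
  [Ring B] [HopfAlgebra K B] [Ring B'] [HopfAlgebra K B'] [Ring T] [HopfAlgebra K T]
  {ξ : B →ₗ[K] A →ₗ[K] A}

/-- Restriction of an action along a Hopf algebra morphism `f : B' → B`. -/
theorem IsModuleHopf.comp (h : IsModuleHopf ξ) (f : B' →ₐc[K] B) :
    IsModuleHopf (ξ ∘ₗ (f : B' →ₗ[K] B)) where
  mul_act b b' x := by
    change ξ (f (b * b')) x = ξ (f b) (ξ (f b') x)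
    rw [map_mul, h.mul_act]
  one_act x := by
    change ξ (f 1) x = x
    rw [map_one, h.one_act]
  act_mul b x y := by
    refine (h.act_mul (f b) x y).trans ?_
    rw [← CoalgHomClass.map_comp_comul_apply, ← LinearMap.comp_apply (TensorProduct.map _ _),
      ← TensorProduct.map_comp]
    rfl
  act_one b := by
    refine (h.act_one (f b)).trans ?_
    rw [CoalgHomClass.counit_comp_apply]
  comul_act b x := by
    refine (h.comul_act (f b) x).trans ?_
    rw [← CoalgHomClass.map_comp_comul_apply]
    generalize comul (R := K) b = u
    generalize comul (R := K) x = v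
    induction u with
    | zero => simp
    | add u u' h h' => simp only [map_add, LinearMap.add_apply, h, h']
    | tmul u u' =>
      induction v with
      | zero => simp
      | add v v' h h' => simp only [map_add, h, h']
      | tmul v v' => rfl
  counit_act b x := by
    refine (h.counit_act (f b) x).trans ?_
    rw [CoalgHomClass.counit_comp_apply]

variable [IsCocomm K A] [IsCocomm K B] [IsCocomm K B'] [IsCocomm K T]
  (h : IsModuleHopf ξ) (f : B' →ₐc[K] B)

/-- The projection `A ⋊ B' → A ⋊ B`, `a ⊗ b' ↦ a ⊗ f(b')`, out of the smash product with the
restricted action. It exhibits `A ⋊ B'` as the pullback of `p₂ : A ⋊ B → B` along `f`. -/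
noncomputable def smashBase : Smash (h.comp f) →ₐc[K] Smash h :=
  smashMap (h.comp f) h (BialgHom.id K A) f fun _ _ => rfl

theorem smashDom_smashBase (w : Smash (h.comp f)) :
    smashDom h (smashBase h f w) = f (smashDom (h.comp f) w) := by
  refine smash_ext (h.comp f) (f := (smashDom h).comp (smashBase h f))
    (g := f.comp (smashDom (h.comp f))) (fun a b => ?_) w
  change counit (R := K) a • f b = f (counit (R := K) a • b)
  rw [map_smul]

omit [IsCocomm K B'] in
theorem smashFst_smashBase (w : Smash (h.comp f)) :
    smashFst h (smashBase h f w) = smashFst (h.comp f) w := by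
  have e : (smashFst h).toLinearMap ∘ₗ (smashBase h f : _ →ₗc[K] Smash h).toLinearMap =
      (smashFst (h.comp f)).toLinearMap := by
    refine TensorProduct.ext' (M := A) (N := B') fun a b => ?_
    change counit (R := K) (f b) • a = counit (R := K) b • a
    rw [CoalgHomClass.counit_comp_apply]
  exact congr($e w)

omit [IsCocomm K B'] in
theorem smashAct_smashBase (w : Smash (h.comp f)) (a : A) :
    smashAct h (smashBase h f w) a = smashAct (h.comp f) w a := by
  have e : (smashAct h).flip a ∘ₗ (smashBase h f : _ →ₗc[K] Smash h).toLinearMap =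
      (smashAct (h.comp f)).flip a :=
    TensorProduct.ext' (M := A) (N := B') fun a b => rfl
  exact congr($e w)

section Lift

variable (s : T →ₐc[K] Smash h) (v : T →ₐc[K] B') (hsv : ∀ t, smashDom h (s t) = f (v t))

include hsv in
theorem smashBase_smashPairCoalg (t : T) :
    smashBase h f (smashPairCoalg (h.comp f) ((smashFst h).comp (s : T →ₗc[K] Smash h))
      (v : T →ₗc[K] B') t) = s t := by
  refine smash_coalgHom_ext h (g := (smashBase h f : _ →ₗc[K] Smash h).comp
    (smashPairCoalg (h.comp f) ((smashFst h).comp (s : T →ₗc[K] Smash h)) (v : T →ₗc[K] B')))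
    (g' := (s : T →ₗc[K] Smash h)) (fun t => ?_) (fun t => ?_) t
  · exact (smashFst_smashBase h f _).trans (smashFst_smashPairCoalg _ _ _ t)
  · exact (smashDom_smashBase h f _).trans
      ((congrArg f (smashSnd_smashPairCoalg _ _ _ t)).trans (hsv t).symm)

/-- The universal property of the pullback `A ⋊ B'`. -/
noncomputable def smashBaseLift : T →ₐc[K] Smash (h.comp f) :=
  smashPair (h.comp f) ((smashFst h).comp (s : T →ₗc[K] Smash h)) v
    ((congrArg (smashFst h) (map_one s)).trans (smashFst_smashInlHom h 1))
    fun t t' => by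
      refine (congrArg (smashFst h) (map_mul s t t')).trans ((smashFst_mul h _ _).trans ?_)
      rw [← smashAct_smashBase, smashBase_smashPairCoalg h f s v hsv]
      rfl

theorem smashBase_smashBaseLift (t : T) : smashBase h f (smashBaseLift h f s v hsv t) = s t :=
  smashBase_smashPairCoalg h f s v hsv t

theorem smashDom_smashBaseLift (t : T) : smashDom (h.comp f) (smashBaseLift h f s v hsv t) = v t :=
  smashSnd_smashPairCoalg (h.comp f) ((smashFst h).comp (s : T →ₗc[K] Smash h))
    (v : T →ₗc[K] B') t

end Lift

omit [IsCocomm K B'] [IsCocomm K T] in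
theorem smashBase_hom_ext {g g' : T →ₐc[K] Smash (h.comp f)}
    (h1 : ∀ t, smashBase h f (g t) = smashBase h f (g' t))
    (h2 : ∀ t, smashDom (h.comp f) (g t) = smashDom (h.comp f) (g' t)) (t : T) : g t = g' t := by
  refine smash_coalgHom_ext (h.comp f) (g := (g : T →ₗc[K] _)) (g' := (g' : T →ₗc[K] _))
    (fun t => ?_) h2 t
  refine (smashFst_smashBase h f _).symm.trans (Eq.trans ?_ (smashFst_smashBase h f _))
  exact congr(smashFst h $(h1 t))

end BaseChange

/-! ### Composition and inversion in the smash product of a crossed module -/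

section Crossed

variable {K : Type u} [Field K] {A B : Type v} [Ring A] [HopfAlgebra K A]
  [Ring B] [HopfAlgebra K B] {ξ : B →ₗ[K] A →ₗ[K] A}
  (h : IsModuleHopf ξ)

/-- The action `B ⊗ A → A` as a coalgebra morphism. -/
noncomputable def actCoalgHom : B ⊗[K] A →ₗc[K] A where
  __ := TensorProduct.lift ξ
  counit_comp := TensorProduct.ext' fun b x => (h.counit_act b x).trans (by simp [mul_comm])
  map_comp_comul := TensorProduct.ext' fun b x => by
    refine Eq.trans ?_ (h.comul_act b x).symm
    rw [LinearMap.comp_apply, TensorProduct.comul_tmul]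
    generalize comul (R := K) b = u
    generalize comul (R := K) x = v
    induction u with
    | zero => simp
    | add u u' h h' =>
      simp only [map_add, LinearMap.add_apply, TensorProduct.add_tmul, h, h']
    | tmul u u' =>
      induction v with
      | zero => simp
      | add v v' h h' => simp only [map_add, TensorProduct.tmul_add, h, h']
      | tmul v v' => rfl

include h in
/-- The action commutes with the antipode: both sides are convolution inverse to the action
`B ⊗ A → A`. -/
theorem antipode_act (b : B) (x : A) : antipode K (ξ b x) = ξ b (antipode K x) := by
  have h1 := antipode_conv_left (actCoalgHom h)
  have h2 : toConv (actCoalgHom h).toLinearMap *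
      toConv (TensorProduct.lift (ξ.compl₂ (antipode K))) = 1 := by
    apply WithConv.ofConv_injective
    refine TensorProduct.ext' fun b x => ?_
    refine (Coalgebra.Repr.convMul_apply ((ℛ K b).tmul (ℛ K x)) _ _).trans ?_
    have e := sum_mul_antipode_eq_algebraMap_counit (ℛ K x)
    have e2 : ∀ y z, ξ b (y * z) = ∑ k ∈ (ℛ K b).index,
        ξ ((ℛ K b).left k) y * ξ ((ℛ K b).right k) z := by
      intro y z
      rw [h.act_mul, ← (ℛ K b).eq]
      simp
    have e3 := congr(ξ b $e)
    simp only [map_sum, e2] at e3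
    rw [Finset.sum_comm] at e3
    refine (Finset.sum_product (ℛ K b).index (ℛ K x).index _).trans (e3.trans ?_)
    rw [Algebra.algebraMap_eq_smul_one, map_smul, h.act_one, smul_smul]
    change _ = algebraMap K A (counit (b ⊗ₜ[K] x))
    rw [Algebra.algebraMap_eq_smul_one]
    simp
  exact congr(ofConv $(left_inv_eq_right_inv h1 h2) (b ⊗ₜ x))

variable [IsCocomm K A] [IsCocomm K B]
  (d : A →ₐc[K] B) (hd : ∀ b a, d (ξ b a) = ad K b (d a)) (hp : ∀ y x, ξ (d y) x = ad K y x)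

include hp in
/-- By the Peiffer identity, `A ⋊ B` acts on `A` through `p₁` in the same way as by conjugation. -/
theorem smashInlHom_act_smashCod (w : Smash h) (a : A) :
    smashInlHom h (ξ (smashCod h d hd w) a) = ad K w (smashInlHom h a) := by
  have e : (smashInlHom h : A →ₗc[K] Smash h).toLinearMap ∘ₗ ξ.flip a ∘ₗ
      (smashCod h d hd : Smash h →ₗc[K] B).toLinearMap =
      (ad K).toLinearMap.flip (smashInlHom h a) := by
    refine TensorProduct.ext' (M := A) (N := B) fun x b => ?_
    change smashInlHom h (ξ (d x * b) a) =
      ad K (A := Smash h) (x ⊗ₜ[K] b : A ⊗[K] B) (smashInlHom h a)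
    rw [← smashInl_mul_smashInr h, map_mul (ad K)]
    refine Eq.trans ?_ (congrArg (ad K (smashInlHom h x)) (ad_smashUnit_smashInlHom h b a)).symm
    rw [ad_smashInlHom, h.mul_act, hp]
  exact congr($e w)

/-- The composition `x ⊗ (x' ⊗ b) ↦ x x' ⊗ b` of the groupoid `A ⋊ B ⇉ B`. The object of
composable pairs is encoded as `A ⋊ (A ⋊ B)`, with `A ⋊ B` acting on `A` through `p₁`. -/
noncomputable def smashCompHom : Smash (h.comp (smashCod h d hd)) →ₐc[K] Smash h :=
  smashDesc (h.comp (smashCod h d hd)) (smashInlHom h) (BialgHom.id K (Smash h))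
    fun w a => smashInlHom_act_smashCod h d hd hp w a

/-- The composition of the arrows `f` and `g` is `inl(fst(f)) g` in the convolution algebra. -/
theorem toConv_smashCompHom :
    toConv (smashCompHom h d hd hp : _ →ₗc[K] Smash h).toLinearMap =
      toConv ((smashInlHom h : A →ₗc[K] Smash h).toLinearMap ∘ₗ (smashFst h).toLinearMap ∘ₗ
        (smashBase h (smashCod h d hd) : _ →ₗc[K] Smash h).toLinearMap) *
      toConv (smashDom (h.comp (smashCod h d hd)) :
        Smash (h.comp (smashCod h d hd)) →ₗc[K] Smash h).toLinearMap := by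
  refine (toConv_smashDesc (h.comp (smashCod h d hd)) (smashInlHom h) (BialgHom.id K (Smash h))
    fun w a => smashInlHom_act_smashCod h d hd hp w a).trans ?_
  congr 2
  ext w
  exact congrArg (smashInlHom h) (smashFst_smashBase h _ w).symm

omit [IsCocomm K A] [IsCocomm K B] in
theorem smashAct_smashPairCoalg {C : Type v} [AddCommGroup C] [Module K C] [Coalgebra K C]
    [IsCocomm K C] (j : C →ₗc[K] A) (v : C →ₗc[K] B) (a : A) :
    toConv ((smashAct h).flip a ∘ₗ (smashPairCoalg h j v).toLinearMap) =
      toConv j.toLinearMap * toConv (ξ.flip a ∘ₗ v.toLinearMap) := by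
  ext c
  rw [(ℛ K c).convMul_apply]
  refine (congrArg ((smashAct h).flip a) (smashPairCoalg_apply h j v (ℛ K c))).trans ?_
  exact map_sum ((smashAct h).flip a) _ _

include hp in
/-- In the groupoid `A ⋊ B ⇉ B` the inverse of `(x, b)` has components `(x⁻¹, d(x) b)`; the
`A`-component is a crossed homomorphism along `p₁`. -/
theorem antipode_smashFst_mul (w w' : Smash h) :
    antipode K (smashFst h (w * w')) =
      smashAct h (smashPairCoalg h ((antipodeCoalgHom K A).comp (smashFst h))
        (smashCod h d hd : Smash h →ₗc[K] B) w) (antipode K (smashFst h w')) := by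
  rw [smashFst_mul]
  generalize smashFst h w' = a
  -- `G a` is `x ⊗ b ↦ (ᵇa) S(x)`; by the Peiffer identity `^{p₁(w)}a = fst(w₁) G a (w₂)`, and the
  -- factor `S(fst(w₁))` of the pair cancels `fst(w₂)`.
  let G : A → (Smash h →ₗ[K] A) := fun a => TensorProduct.lift (M := A) (N := B)
    ((LinearMap.mul K A).flip.compl₁₂ (antipode K) (ξ.flip a))
  have hG : ∀ a x b, G a (x ⊗ₜ[K] b : A ⊗[K] B) = ξ b a * antipode K x := fun _ _ _ => rfl
  have e1 : antipode K ∘ₗ (smashAct h).flip a = G (antipode K a) := by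
    refine TensorProduct.ext' (M := A) (N := B) fun x b => ?_
    change antipode K (x * ξ b a) = G (antipode K a) (x ⊗ₜ[K] b : A ⊗[K] B)
    rw [hG, antipode_mul_antidistrib, antipode_act h]
  have e2 : ∀ a, toConv (ξ.flip a ∘ₗ (smashCod h d hd : Smash h →ₗc[K] B).toLinearMap) =
      toConv (smashFst h).toLinearMap * toConv (G a) := by
    intro a
    apply WithConv.ofConv_injective
    refine TensorProduct.ext' (M := A) (N := B) fun x b => ?_
    refine Eq.trans ?_ (Coalgebra.Repr.convMul_apply
      (((ℛ K x).tmul (ℛ K b) : Coalgebra.Repr K (x ⊗ₜ[K] b : A ⊗[K] B) _))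
      (toConv (smashFst h).toLinearMap) (toConv (G a))).symm
    refine Eq.trans ?_ (Finset.sum_product (ℛ K x).index (ℛ K b).index _).symm
    change ξ (d x * b) a = ∑ i ∈ (ℛ K x).index, ∑ j ∈ (ℛ K b).index,
      (counit (R := K) ((ℛ K b).left j) • (ℛ K x).left i) *
        (ξ ((ℛ K b).right j) a * antipode K ((ℛ K x).right i))
    rw [h.mul_act, hp, ad_repr (ℛ K x)]
    refine Finset.sum_congr rfl fun i _ => ?_
    conv_lhs => rw [← sum_counit_smul (ℛ K b)]
    simp [Finset.sum_mul, Finset.mul_sum, mul_assoc]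
  have e3 : toConv (antipode K ∘ₗ (smashFst h).toLinearMap) * toConv (smashFst h).toLinearMap = 1 :=
    antipode_conv_left (smashFst h)
  have e4 := smashAct_smashPairCoalg h ((antipodeCoalgHom K A).comp (smashFst h))
    (smashCod h d hd : Smash h →ₗc[K] B) (antipode K a)
  rw [e2] at e4
  change _ = toConv (antipode K ∘ₗ (smashFst h).toLinearMap) * _ at e4
  rw [← mul_assoc, e3, one_mul, ← e1] at e4
  exact congr(ofConv $e4.symm w)

/-- The inversion `x ⊗ b ↦ S(x₁) ⊗ d(x₂) b` of the groupoid `A ⋊ B ⇉ B`. -/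
noncomputable def smashInv : Smash h →ₐc[K] Smash h :=
  smashPair h ((antipodeCoalgHom K A).comp (smashFst h)) (smashCod h d hd)
    ((congrArg (antipode K) (smashFst_smashInlHom h 1)).trans antipode_one)
    (antipode_smashFst_mul h d hd hp)

theorem smashFst_smashInv (w : Smash h) :
    smashFst h (smashInv h d hd hp w) = antipode K (smashFst h w) :=
  smashFst_smashPairCoalg h ((antipodeCoalgHom K A).comp (smashFst h)) _ w

theorem smashDom_smashInv (w : Smash h) :
    smashDom h (smashInv h d hd hp w) = smashCod h d hd w :=
  smashSnd_smashPairCoalg h ((antipodeCoalgHom K A).comp (smashFst h)) _ w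

end Crossed

/-! ### Isomorphisms in the categories involved -/

namespace InternalGroupoid

variable {C : Type u} [Category.{v} C]

/-- An internal functor is invertible as soon as its two components are: the inverse preserves the
multiplication automatically. -/
noncomputable def isoOfIsIso {G H : InternalGroupoid C} (f : G ⟶ H) [IsIso f.f₁] [IsIso f.f₀] :
    G ≅ H where
  hom := f
  inv :=
    { f₁ := inv f.f₁
      f₀ := inv f.f₀
      comm_δ := by simp [← f.comm_δ]
      comm_γ := by simp [← f.comm_γ]
      comm_i := by simp [f.comm_i]
      comm_m := by
        rw [IsIso.comp_inv_eq, Category.assoc, f.comm_m, ← Category.assoc]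
        refine (Category.id_comp _).symm.trans (congrArg (· ≫ H.m) ?_)
        exact H.isPullback.hom_ext (by simp) (by simp) }
  hom_inv_id := Hom.ext (IsIso.hom_inv_id f.f₁) (IsIso.hom_inv_id f.f₀)
  inv_hom_id := Hom.ext (IsIso.inv_hom_id f.f₁) (IsIso.inv_hom_id f.f₀)

end InternalGroupoid

section Categories

variable {K : Type u} [Field K]

/-- The isomorphism of the category given by an isomorphism of Hopf algebras. -/
def isoOfBialgEquiv {X Y : CocommHopf.{u, v} K} (e : X.obj ≃ₐc[K] Y.obj) : X ≅ Y where
  hom := ofHom (e : X.obj →ₐc[K] Y.obj)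
  inv := ofHom (e.symm : Y.obj →ₐc[K] X.obj)
  hom_inv_id := cocommHopf_ext e.symm_apply_apply
  inv_hom_id := cocommHopf_ext e.apply_symm_apply

/-- A morphism of module Hopf maps is invertible as soon as its two components are. -/
noncomputable def ModuleHopfMap.isoOfIsIso {M N : ModuleHopfMap.{u, v} K} (f : M ⟶ N)
    [IsIso f.α] [IsIso f.β] : M ≅ N where
  hom := f
  inv :=
    { α := inv f.α
      β := inv f.β
      comm_d := by simp [← f.comm_d]
      map_act := fun b x => by
        have hα : ∀ x, toHom f.α (toHom (inv f.α) x) = x := fun x =>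
          congr(toHom $(IsIso.inv_hom_id f.α) x)
        have hβ : ∀ x, toHom f.β (toHom (inv f.β) x) = x := fun x =>
          congr(toHom $(IsIso.inv_hom_id f.β) x)
        have hα' : ∀ x, toHom (inv f.α) (toHom f.α x) = x := fun x =>
          congr(toHom $(IsIso.hom_inv_id f.α) x)
        have e := f.map_act (toHom (inv f.β) b) (toHom (inv f.α) x)
        rw [hα, hβ] at e
        rw [← e, hα'] }
  hom_inv_id := Hom.ext (IsIso.hom_inv_id f.α) (IsIso.hom_inv_id f.β)
  inv_hom_id := Hom.ext (IsIso.inv_hom_id f.α) (IsIso.inv_hom_id f.β)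

/-! ### The groupoid of a Hopf crossed module -/

section SmashGroupoid

variable (M : HXMod.{u, v} K)

/-- The codomain morphism `p₁ : X ⋊ B → B` as a morphism of Hopf algebras. -/
noncomputable abbrev codHom : Smash M.obj.isModuleHopf →ₐc[K] M.obj.B.obj :=
  smashCod M.obj.isModuleHopf (toHom M.obj.d) M.property.d_act

/-- The object `X ⋊ (X ⋊ B)` of composable pairs of the groupoid `X ⋊ B ⇉ B`. -/
noncomputable def smashPairs : CocommHopf.{u, v} K :=
  CocommHopf.of (Smash (M.obj.isModuleHopf.comp (codHom M)))

/-- The first arrow `x ⊗ d(x')b` of the composable pair `x ⊗ (x' ⊗ b)`. -/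
noncomputable def smashPairsFst : smashPairs M ⟶ (smashObj M).A₁ :=
  ofHom (X := smashPairs M) (Y := (smashObj M).A₁) (smashBase M.obj.isModuleHopf (codHom M))

/-- The second arrow `x' ⊗ b` of the composable pair `x ⊗ (x' ⊗ b)`. -/
noncomputable def smashPairsSnd : smashPairs M ⟶ (smashObj M).A₁ :=
  ofHom (X := smashPairs M) (Y := (smashObj M).A₁)
    (smashDom (M.obj.isModuleHopf.comp (codHom M)))

/-- The composition of the groupoid `X ⋊ B ⇉ B`. -/
noncomputable def smashPairsComp : smashPairs M ⟶ (smashObj M).A₁ :=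
  ofHom (X := smashPairs M) (Y := (smashObj M).A₁)
    (smashCompHom M.obj.isModuleHopf (toHom M.obj.d) M.property.d_act M.property.peiffer)

theorem smash_isPullback :
    IsPullback (smashPairsFst M) (smashPairsSnd M) (smashObj M).δ (smashObj M).γ :=
  IsPullback.mk ⟨cocommHopf_ext (smashDom_smashBase M.obj.isModuleHopf (codHom M))⟩
    ⟨Limits.PullbackCone.IsLimit.mk _
      (fun s => ofHom (Y := smashPairs M) (smashBaseLift M.obj.isModuleHopf (codHom M)
        (toHom s.fst) (toHom s.snd) fun t => congr(toHom $s.condition t)))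
      (fun s => cocommHopf_ext fun t => smashBase_smashBaseLift M.obj.isModuleHopf (codHom M)
        (toHom s.fst) (toHom s.snd) (fun t => congr(toHom $s.condition t)) t)
      (fun s => cocommHopf_ext fun t => smashDom_smashBaseLift M.obj.isModuleHopf (codHom M)
        (toHom s.fst) (toHom s.snd) (fun t => congr(toHom $s.condition t)) t)
      (fun s m h1 h2 => cocommHopf_ext <| smashBase_hom_ext M.obj.isModuleHopf (codHom M)
        (g := toHom m)
        (fun t => congr(toHom $h1 t).trans
          (smashBase_smashBaseLift M.obj.isModuleHopf (codHom M)
            (toHom s.fst) (toHom s.snd) (fun t => congr(toHom $s.condition t)) t).symm)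
        (fun t => congr(toHom $h2 t).trans
          (smashDom_smashBaseLift M.obj.isModuleHopf (codHom M)
            (toHom s.fst) (toHom s.snd) (fun t => congr(toHom $s.condition t)) t).symm))⟩

/-- The linear map `x ⊗ b ↦ ε(b) x ⊗ 1`, the analogue of `a ↦ a (1_{δ a})⁻¹`. -/
noncomputable def smashKerPart : (smashObj M).A₁.obj →ₗ[K] (smashObj M).A₁.obj :=
  (smashInl M.obj.isModuleHopf).toLinearMap ∘ₗ (smashFst M.obj.isModuleHopf).toLinearMap

theorem smashKerPart_mul (x y : (smashObj M).A₁.obj) :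
    smashKerPart M (smashKerPart M x * y) = smashKerPart M x * smashKerPart M y := by
  let h := M.obj.isModuleHopf
  change Smash h at x y
  change smashInl h (smashFst h (smashInl h (smashFst h x) * y)) =
    smashInl h (smashFst h x) * smashInl h (smashFst h y)
  rw [← map_mul (smashInl h), smashFst_mul]
  congr 1
  exact congrArg (smashFst h x * ·) (h.one_act _)

/-- The composite of generalized arrows `f` and `g` is `f (1_{δ f})⁻¹ g` for the convolution
product. -/
theorem toConv_lift_comp {T : CocommHopf.{u, v} K} (f g : T ⟶ (smashObj M).A₁)
    (w : f ≫ (smashObj M).δ = g ≫ (smashObj M).γ) :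
    toConv (toHom ((smash_isPullback M).lift f g w ≫ smashPairsComp M)).toLinearMap =
      toConv (smashKerPart M ∘ₗ (toHom f).toLinearMap) * toConv (toHom g).toLinearMap := by
  have e := LinearMap.convMul_comp_coalgHom_distrib
    (toConv (smashKerPart M ∘ₗ (toHom (smashPairsFst M)).toLinearMap))
    (toConv (toHom (smashPairsSnd M)).toLinearMap)
    (toHom ((smash_isPullback M).lift f g w)).toCoalgHom
  have e0 := toConv_smashCompHom M.obj.isModuleHopf (toHom M.obj.d) M.property.d_act
    M.property.peiffer
  have e1 : (toHom (smashPairsFst M)).toLinearMap ∘ₗ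
      (toHom ((smash_isPullback M).lift f g w)).toLinearMap = (toHom f).toLinearMap :=
    congr((toHom $((smash_isPullback M).lift_fst f g w)).toLinearMap)
  have e2 : (toHom (smashPairsSnd M)).toLinearMap ∘ₗ
      (toHom ((smash_isPullback M).lift f g w)).toLinearMap = (toHom g).toLinearMap :=
    congr((toHom $((smash_isPullback M).lift_snd f g w)).toLinearMap)
  dsimp only at e
  rw [LinearMap.comp_assoc, e1, e2] at e
  refine Eq.trans ?_ congr(toConv $e)
  exact congr(toConv (ofConv $e0 ∘ₗ (toHom ((smash_isPullback M).lift f g w)).toLinearMap))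

theorem hom_ext_of_toConv_eq {X Y : CocommHopf.{u, v} K} {f g : X ⟶ Y}
    (e : toConv (toHom f).toLinearMap = toConv (toHom g).toLinearMap) : f = g :=
  cocommHopf_ext fun x => congr(ofConv $e x)

theorem smashPairsComp_eq : toConv (toHom (smashPairsComp M)).toLinearMap =
    toConv (smashKerPart M ∘ₗ (toHom (smashPairsFst M)).toLinearMap) *
      toConv (toHom (smashPairsSnd M)).toLinearMap :=
  toConv_smashCompHom M.obj.isModuleHopf (toHom M.obj.d) M.property.d_act M.property.peiffer

theorem comp_smashKerPart_lift_comp {T : CocommHopf.{u, v} K} (f g : T ⟶ (smashObj M).A₁)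
    (w : f ≫ (smashObj M).δ = g ≫ (smashObj M).γ) :
    toConv (smashKerPart M ∘ₗ
        (toHom ((smash_isPullback M).lift f g w ≫ smashPairsComp M)).toLinearMap) =
      toConv (smashKerPart M ∘ₗ (toHom f).toLinearMap) *
        toConv (smashKerPart M ∘ₗ (toHom g).toLinearMap) := by
  ext t
  have e := congr($(toConv_lift_comp M f g w) t)
  rw [(ℛ K t).convMul_apply] at e ⊢
  refine (congrArg (smashKerPart M) e).trans ?_
  rw [map_sum]
  exact Finset.sum_congr rfl fun k _ => smashKerPart_mul M _ _

/-- The inversion of the groupoid `X ⋊ B ⇉ B`. -/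
noncomputable def smashInversion : (smashObj M).A₁ ⟶ (smashObj M).A₁ :=
  ofHom (X := (smashObj M).A₁) (Y := (smashObj M).A₁)
    (smashInv M.obj.isModuleHopf (toHom M.obj.d) M.property.d_act M.property.peiffer)

/-- A generalized arrow `f` is the product of its `X`-component and the identity of its domain. -/
theorem smash_decomposition {T : CocommHopf.{u, v} K} (f : T ⟶ (smashObj M).A₁) :
    toConv (toHom f).toLinearMap = toConv (smashKerPart M ∘ₗ (toHom f).toLinearMap) *
      toConv (toHom (f ≫ (smashObj M).δ ≫ (smashObj M).i)).toLinearMap := by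
  have e := LinearMap.convMul_comp_coalgHom_distrib
    (toConv ((smashInl M.obj.isModuleHopf).toLinearMap ∘ₗ
      (smashFst M.obj.isModuleHopf).toLinearMap))
    (toConv ((smashInr M.obj.isModuleHopf).toLinearMap ∘ₗ
      (smashSnd M.obj.isModuleHopf).toLinearMap)) (toHom f).toCoalgHom
  rw [← smash_id_eq M.obj.isModuleHopf] at e
  exact congr(toConv $e)

theorem smashInversion_δ : smashInversion M ≫ (smashObj M).δ = (smashObj M).γ :=
  cocommHopf_ext (smashDom_smashInv M.obj.isModuleHopf (toHom M.obj.d) M.property.d_act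
    M.property.peiffer)

theorem smashKerPart_smashInversion :
    smashKerPart M ∘ₗ (toHom (smashInversion M)).toLinearMap =
      (smashInl M.obj.isModuleHopf).toLinearMap ∘ₗ antipode K ∘ₗ
        (smashFst M.obj.isModuleHopf).toLinearMap :=
  LinearMap.ext fun w => congrArg (smashInl M.obj.isModuleHopf)
    (smashFst_smashInv M.obj.isModuleHopf (toHom M.obj.d) M.property.d_act M.property.peiffer w)

theorem smashInversion_mul_smashKerPart :
    toConv (smashKerPart M ∘ₗ (toHom (smashInversion M)).toLinearMap) *
      toConv (smashKerPart M) = 1 := by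
  rw [smashKerPart_smashInversion]
  exact algHom_antipode_left (smashInl M.obj.isModuleHopf) (smashFst M.obj.isModuleHopf)

theorem smashKerPart_mul_smashInversion :
    toConv (smashKerPart M) *
      toConv (smashKerPart M ∘ₗ (toHom (smashInversion M)).toLinearMap) = 1 := by
  rw [smashKerPart_smashInversion]
  exact algHom_antipode_right (smashInl M.obj.isModuleHopf) (smashFst M.obj.isModuleHopf)

theorem smash_decomposition_comp {T S : CocommHopf.{u, v} K} (f : T ⟶ (smashObj M).A₁)
    (g : (smashObj M).A₁ ⟶ S) : toConv (toHom (f ≫ g)).toLinearMap =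
      toConv ((toHom g).toLinearMap ∘ₗ smashKerPart M ∘ₗ (toHom f).toLinearMap) *
        toConv (toHom (f ≫ (smashObj M).δ ≫ (smashObj M).i ≫ g)).toLinearMap := by
  have e := LinearMap.algHom_comp_convMul_distrib (toHom g : _ →ₐ[K] S.obj)
    (toConv (smashKerPart M ∘ₗ (toHom f).toLinearMap))
    (toConv (toHom (f ≫ (smashObj M).δ ≫ (smashObj M).i)).toLinearMap)
  rw [← smash_decomposition] at e
  exact congr(toConv $e)

theorem smashInversion_γ : smashInversion M ≫ (smashObj M).γ = (smashObj M).δ := by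
  have e1 := smash_decomposition_comp M (smashInversion M) (smashObj M).γ
  have e2 := smash_decomposition_comp M (𝟙 _) (smashObj M).γ
  have e3 := LinearMap.algHom_comp_convMul_distrib
    (toHom (smashObj M).γ : (smashObj M).A₁.obj →ₐ[K] (smashObj M).A₀.obj)
    (toConv (smashKerPart M ∘ₗ (toHom (smashInversion M)).toLinearMap)) (toConv (smashKerPart M))
  rw [smashInversion_mul_smashKerPart] at e3
  have e4 : toConv ((toHom (smashObj M).γ).toLinearMap ∘ₗ smashKerPart M ∘ₗ
      (toHom (smashInversion M)).toLinearMap) *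
      toConv ((toHom (smashObj M).γ).toLinearMap ∘ₗ smashKerPart M) = 1 := by
    apply WithConv.ofConv_injective
    refine e3.symm.trans (LinearMap.ext fun w => ?_)
    exact AlgHomClass.commutes (toHom (smashObj M).γ) (counit w)
  rw [reassoc_of% smashInversion_δ, (smashObj M).i_γ, Category.comp_id] at e1
  rw [Category.id_comp, Category.id_comp, (smashObj M).i_γ, Category.comp_id] at e2
  apply hom_ext_of_toConv_eq
  rw [e1, e2, ← mul_assoc]
  refine (congrArg (· * toConv (toHom (smashObj M).δ).toLinearMap) e4).trans ?_
  rw [one_mul]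

/-- Morphisms out of `X ⋊ B` are determined by their values on `x ⊗ 1` and `1 ⊗ b`. -/
theorem smashObj_hom_ext {T : CocommHopf.{u, v} K} {f g : (smashObj M).A₁ ⟶ T}
    (h1 : ∀ x, toHom f (smashInlHom M.obj.isModuleHopf x) =
      toHom g (smashInlHom M.obj.isModuleHopf x))
    (h2 : (smashObj M).i ≫ f = (smashObj M).i ≫ g) : f = g :=
  cocommHopf_ext <| smash_hom_ext M.obj.isModuleHopf (f := toHom f) (g := toHom g) h1
    fun b => congr(toHom $h2 b)

theorem smashCod_smashInlHom (x : M.obj.X.obj) :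
    toHom (smashObj M).γ (smashInlHom M.obj.isModuleHopf x) = toHom M.obj.d x :=
  mul_one (toHom M.obj.d x)

theorem smashDom_smashInlHom (x : M.obj.X.obj) :
    toHom (smashObj M).δ (smashInlHom M.obj.isModuleHopf x) =
      algebraMap K M.obj.B.obj (counit (R := K) x) :=
  (Algebra.algebraMap_eq_smul_one (A := M.obj.B.obj) (counit (R := K) x)).symm

/-- The inclusion `X ⟶ X ⋊ (X ⋊ B)` of the composable pairs whose second arrow is `1`. -/
noncomputable def smashPairsInl : M.obj.X ⟶ smashPairs M :=
  ofHom (Y := smashPairs M) (smashInlHom (M.obj.isModuleHopf.comp (codHom M)))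

/-- The inclusion `X ⋊ B ⟶ X ⋊ (X ⋊ B)` of the composable pairs whose first arrow is an
identity. -/
noncomputable def smashPairsInr : (smashObj M).A₁ ⟶ smashPairs M :=
  ofHom (X := (smashObj M).A₁) (Y := smashPairs M)
    (smashUnit (M.obj.isModuleHopf.comp (codHom M)))

/-- The inclusion `x ↦ x ⊗ 1`. -/
noncomputable def smashObjInl : M.obj.X ⟶ (smashObj M).A₁ :=
  ofHom (Y := (smashObj M).A₁) (smashInlHom M.obj.isModuleHopf)

variable {M} in
theorem smashPairs_hom_ext {T : CocommHopf.{u, v} K} {f g : smashPairs M ⟶ T}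
    (h1 : smashPairsInl M ≫ f = smashPairsInl M ≫ g)
    (h2 : smashPairsInr M ≫ f = smashPairsInr M ≫ g) : f = g :=
  cocommHopf_ext <| smash_hom_ext (M.obj.isModuleHopf.comp (codHom M)) (f := toHom f)
    (g := toHom g) (fun x => congr(toHom $h1 x)) (fun w => congr(toHom $h2 w))

theorem smashPairsInl_fst : smashPairsInl M ≫ smashPairsFst M = smashObjInl M :=
  cocommHopf_ext fun x => by
    change (x ⊗ₜ[K] codHom M 1 : M.obj.X.obj ⊗[K] M.obj.B.obj) = x ⊗ₜ[K] 1
    rw [map_one]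

theorem smashPairsInl_snd : smashPairsInl M ≫ smashPairsSnd M =
    smashObjInl M ≫ (smashObj M).δ ≫ (smashObj M).i :=
  cocommHopf_ext fun x => by
    refine Eq.trans ?_ congr(toHom (smashObj M).i $(smashDom_smashInlHom M x)).symm
    refine Eq.trans ?_ (AlgHomClass.commutes (toHom (smashObj M).i) _).symm
    exact (Algebra.algebraMap_eq_smul_one (A := Smash M.obj.isModuleHopf)
      (counit (R := K) x)).symm

theorem smashPairsInr_fst : smashPairsInr M ≫ smashPairsFst M =
    (smashObj M).γ ≫ (smashObj M).i :=
  cocommHopf_ext fun _ => rfl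

theorem smashPairsInr_snd : smashPairsInr M ≫ smashPairsSnd M = 𝟙 _ :=
  cocommHopf_ext fun (w : Smash M.obj.isModuleHopf) => by
    change counit (R := K) (1 : M.obj.X.obj) • w = w
    rw [counit_one, one_smul]

theorem smashPairsInl_comp : smashPairsInl M ≫ smashPairsComp M = smashObjInl M :=
  cocommHopf_ext fun x => smashDesc_inl _ _ _
    (smashInlHom_act_smashCod _ _ M.property.d_act M.property.peiffer) x

theorem smashPairsInr_comp : smashPairsInr M ≫ smashPairsComp M = 𝟙 _ :=
  cocommHopf_ext fun x => smashDesc_inr _ _ _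
    (smashInlHom_act_smashCod _ _ M.property.d_act M.property.peiffer) x

/-- The internal groupoid `X ⋊ B ⇉ B` of a Hopf crossed module `d : X → B`. -/
noncomputable def smashGroupoid : InternalGroupoid (CocommHopf.{u, v} K) where
  toReflexiveGraph := smashObj M
  P := smashPairs M
  p₁ := smashPairsFst M
  p₂ := smashPairsSnd M
  isPullback := smash_isPullback M
  m := smashPairsComp M
  m_id := by
    apply hom_ext_of_toConv_eq
    rw [toConv_lift_comp]
    refine Eq.trans ?_ (smash_decomposition M (𝟙 _)).symm
    rw [Category.id_comp]
  id_m := by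
    have e : (smash_isPullback M).lift ((smashObj M).γ ≫ (smashObj M).i) (𝟙 _)
        (by simp [(smashObj M).i_δ]) = smashPairsInr M :=
      (smash_isPullback M).hom_ext (by simp [smashPairsInr_fst]) (by simp [smashPairsInr_snd])
    rw [e, smashPairsInr_comp]
  m_δ := by
    apply smashPairs_hom_ext
    · rw [reassoc_of% smashPairsInl_comp, reassoc_of% smashPairsInl_snd, (smashObj M).i_δ,
        Category.comp_id]
    · rw [reassoc_of% smashPairsInr_comp, reassoc_of% smashPairsInr_snd]
  m_γ := by
    apply smashPairs_hom_ext
    · rw [reassoc_of% smashPairsInl_comp, reassoc_of% smashPairsInl_fst]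
    · rw [reassoc_of% smashPairsInr_comp, reassoc_of% smashPairsInr_fst, (smashObj M).i_γ,
        Category.comp_id]
  assoc f g h hfg hgh := by
    apply hom_ext_of_toConv_eq
    rw [toConv_lift_comp, toConv_lift_comp, toConv_lift_comp, comp_smashKerPart_lift_comp,
      mul_assoc]
  exists_inv := by
    have hδ := smashInversion_δ M
    refine ⟨smashInversion M, hδ, smashInversion_γ M, ?_, ?_⟩
    · apply hom_ext_of_toConv_eq
      have e := smash_decomposition M (𝟙 _)
      rw [toConv_lift_comp, e, ← mul_assoc, Category.id_comp]
      refine Eq.trans (congrArg (· * _) (smashInversion_mul_smashKerPart M)) ?_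
      rw [one_mul]
    · apply hom_ext_of_toConv_eq
      have e := smash_decomposition M (smashInversion M)
      rw [toConv_lift_comp, e, ← mul_assoc, reassoc_of% hδ]
      refine Eq.trans (congrArg (· * _) (smashKerPart_mul_smashInversion M)) ?_
      rw [one_mul]

end SmashGroupoid

end Categories

/-! ### The equivalence of categories -/

section Equivalence

variable {K : Type u} [Field K]

/-- A morphism of reflexive graphs from the smash product groupoid of a Hopf crossed module to an
internal groupoid always preserves the multiplication: the composable pairs `X ⋊ (X ⋊ B)` are
generated by those in which one of the two arrows is an identity. -/
noncomputable def smashGroupoidHom {M : HXMod.{u, v} K} {G : InternalGroupoid (CocommHopf.{u, v} K)}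
    (f : smashObj M ⟶ G.toReflexiveGraph) : smashGroupoid M ⟶ G where
  toHom := f
  comm_m := by
    have w : (smashPairsFst M ≫ f.f₁) ≫ G.δ = (smashPairsSnd M ≫ f.f₁) ≫ G.γ := by
      rw [Category.assoc, Category.assoc, f.comm_δ, f.comm_γ, (smash_isPullback M).w_assoc]
    change smashPairsComp M ≫ f.f₁ = G.isPullback.lift _ _ w ≫ G.m
    apply smashPairs_hom_ext
    · have e : smashPairsInl M ≫ G.isPullback.lift _ _ w = (smashObjInl M ≫ f.f₁) ≫
          G.isPullback.lift (𝟙 _) (G.δ ≫ G.i) (by simp [G.i_γ]) := by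
        apply G.isPullback.hom_ext
        · simp [reassoc_of% smashPairsInl_fst]
        · simp [reassoc_of% smashPairsInl_snd, ← f.comm_i, reassoc_of% f.comm_δ]
      rw [reassoc_of% smashPairsInl_comp, reassoc_of% e, G.m_id, Category.comp_id]
    · have e : smashPairsInr M ≫ G.isPullback.lift _ _ w = f.f₁ ≫
          G.isPullback.lift (G.γ ≫ G.i) (𝟙 _) (by simp [G.i_δ]) := by
        apply G.isPullback.hom_ext
        · simp [reassoc_of% smashPairsInr_fst, ← f.comm_i, reassoc_of% f.comm_γ]
        · simp [reassoc_of% smashPairsInr_snd]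
      rw [reassoc_of% smashPairsInr_comp, reassoc_of% e, G.id_m, Category.comp_id]

variable (K) in
/-- The functor sending a Hopf crossed module `d : X → B` to the groupoid `X ⋊ B ⇉ B`. -/
noncomputable def smashGroupoidFunctor :
    HXMod.{u, v} K ⥤ InternalGroupoid (CocommHopf.{u, v} K) where
  obj := smashGroupoid
  map f := smashGroupoidHom (smashGraphMap f)
  map_id M := InternalGroupoid.Hom.ext
    congr(ReflexiveGraph.Hom.f₁ $((smashFunctor K).map_id M))
    congr(ReflexiveGraph.Hom.f₀ $((smashFunctor K).map_id M))
  map_comp f g := InternalGroupoid.Hom.ext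
    congr(ReflexiveGraph.Hom.f₁ $((smashFunctor K).map_comp f g))
    congr(ReflexiveGraph.Hom.f₀ $((smashFunctor K).map_comp f g))

section Kernel

variable (G : InternalGroupoid (CocommHopf.{u, v} K))

/-- The smash product `HKer δ ⋊ A₁` for the action of `A₁` through `γ`. It represents the
composable pairs `(k iγ(a), a)` and is generated by the pairs `(k, 1)` and `(iγ(a), a)`. -/
noncomputable def kernelPairs : CocommHopf.{u, v} K :=
  CocommHopf.of (Smash ((kerAct_isModuleHopf (toHom G.δ) (toHom G.i)).comp (toHom G.γ)))

/-- The pairs `(k, 1)`. -/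
noncomputable def kernelPairsInl : CocommHopf.of (HKer (toHom G.δ)) ⟶ kernelPairs G :=
  ofHom (X := CocommHopf.of (HKer (toHom G.δ))) (Y := kernelPairs G) (smashInlHom _)

/-- The pairs `(iγ(a), a)`. -/
noncomputable def kernelPairsInr : G.A₁ ⟶ kernelPairs G :=
  ofHom (Y := kernelPairs G) (smashUnit _)

/-- The first arrow `k iγ(a)`. -/
noncomputable def kernelPairsFst : kernelPairs G ⟶ G.A₁ :=
  ofHom (X := kernelPairs G) (smashDesc _ (hker (toHom G.δ)) ((toHom G.i).comp (toHom G.γ))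
    fun a k => coe_kerAct (toHom G.δ) (toHom G.i) (toHom G.γ a) k)

/-- The second arrow `a`. -/
noncomputable def kernelPairsSnd : kernelPairs G ⟶ G.A₁ :=
  ofHom (X := kernelPairs G) (smashDom _)

/-- The inclusion of the Hopf kernel of `δ`. -/
noncomputable def kernelIncl : CocommHopf.of (HKer (toHom G.δ)) ⟶ G.A₁ :=
  ofHom (X := CocommHopf.of (HKer (toHom G.δ))) (hker (toHom G.δ))

theorem kernelPairs_hom_ext {T : CocommHopf.{u, v} K} {f g : kernelPairs G ⟶ T}
    (h1 : kernelPairsInl G ≫ f = kernelPairsInl G ≫ g)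
    (h2 : kernelPairsInr G ≫ f = kernelPairsInr G ≫ g) : f = g :=
  cocommHopf_ext <| smash_hom_ext _ (f := toHom f) (g := toHom g)
    (fun x => congr(toHom $h1 x)) (fun w => congr(toHom $h2 w))

theorem kernelPairsInl_fst : kernelPairsInl G ≫ kernelPairsFst G = kernelIncl G :=
  cocommHopf_ext fun x => smashDesc_inl _ _ _
    (fun a k => coe_kerAct (toHom G.δ) (toHom G.i) (toHom G.γ a) k) x

theorem kernelPairsInr_fst : kernelPairsInr G ≫ kernelPairsFst G = G.γ ≫ G.i :=
  cocommHopf_ext fun x => smashDesc_inr _ _ _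
    (fun a k => coe_kerAct (toHom G.δ) (toHom G.i) (toHom G.γ a) k) x

theorem kernelPairsInl_snd : kernelPairsInl G ≫ kernelPairsSnd G = kernelIncl G ≫ G.δ ≫ G.i :=
  cocommHopf_ext fun (x : HKer (toHom G.δ)) => by
    change counit (R := K) x • (1 : G.A₁.obj) = toHom G.i (toHom G.δ (x : G.A₁.obj))
    rw [apply_of_mem_HKer _ x.2, AlgHomClass.commutes, Algebra.algebraMap_eq_smul_one]
    rfl

theorem kernelPairsInr_snd : kernelPairsInr G ≫ kernelPairsSnd G = 𝟙 _ :=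
  cocommHopf_ext fun a => by
    change counit (R := K) (1 : HKer (toHom G.δ)) • a = a
    rw [counit_one, one_smul]

/-- The multiplication of the groupoid sends the pairs `(k, 1)` and `(iγ(a), a)` to `k` and `a`. -/
theorem exists_kernelPairs_comp : ∃ σ : kernelPairs G ⟶ G.A₁,
    kernelPairsInl G ≫ σ = kernelIncl G ∧ kernelPairsInr G ≫ σ = 𝟙 _ := by
  have w : kernelPairsFst G ≫ G.δ = kernelPairsSnd G ≫ G.γ := by
    apply kernelPairs_hom_ext
    · rw [reassoc_of% kernelPairsInl_fst, reassoc_of% kernelPairsInl_snd, G.i_γ, Category.comp_id]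
    · rw [reassoc_of% kernelPairsInr_fst, reassoc_of% kernelPairsInr_snd, G.i_δ, Category.comp_id]
  refine ⟨G.isPullback.lift _ _ w ≫ G.m, ?_, ?_⟩
  · have e : kernelPairsInl G ≫ G.isPullback.lift _ _ w =
        kernelIncl G ≫ G.isPullback.lift (𝟙 _) (G.δ ≫ G.i) (by simp [G.i_γ]) :=
      G.isPullback.hom_ext (by simp [kernelPairsInl_fst]) (by simp [kernelPairsInl_snd])
    rw [reassoc_of% e, G.m_id, Category.comp_id]
  · have e : kernelPairsInr G ≫ G.isPullback.lift _ _ w =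
        G.isPullback.lift (G.γ ≫ G.i) (𝟙 _) (by simp [G.i_δ]) :=
      G.isPullback.hom_ext (by simp [kernelPairsInr_fst]) (by simp [kernelPairsInr_snd])
    rw [reassoc_of% e, G.id_m]

/-- In an internal groupoid, an arrow `a` and the identity of its codomain act in the same way by
conjugation on `HKer δ`. Indeed, conjugating `(k, 1)` by `(iγ(a), a)` among the composable pairs
gives the action of `γ(a)` on `k`, and the multiplication of the groupoid preserves this
relation. -/
theorem ad_i_γ (a : G.A₁.obj) (x : HKer (toHom G.δ)) :
    ad K (toHom G.i (toHom G.γ a)) (x : G.A₁.obj) = ad K a (x : G.A₁.obj) := by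
  obtain ⟨σ, hl, hr⟩ := exists_kernelPairs_comp G
  have hl' : ∀ x : HKer (toHom G.δ), toHom σ (toHom (kernelPairsInl G) x) = x :=
    fun x => congr(toHom $hl x)
  have hr' : ∀ a, toHom σ (toHom (kernelPairsInr G) a) = a := fun x => congr(toHom $hr x)
  have e : ad K (toHom (kernelPairsInr G) a) (toHom (kernelPairsInl G) x) =
      toHom (kernelPairsInl G) (kerAct (toHom G.δ) (toHom G.i) (toHom G.γ a) x) :=
    ad_smashUnit_smashInlHom
      ((kerAct_isModuleHopf (toHom G.δ) (toHom G.i)).comp (toHom G.γ)) a x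
  have e1 := congr(toHom σ $e)
  rw [hl', ad_map, hl', hr'] at e1
  exact e1.symm

theorem kernelObj_isCrossed : (kernelObj G.toReflexiveGraph).IsCrossed where
  d_act b x := by
    refine (ad_map (toHom G.γ) (toHom G.i b) (Subtype.val x)).trans ?_
    have e : toHom G.γ (toHom G.i b) = b := congr(toHom $(G.i_γ) b)
    rw [e]
    rfl
  peiffer y x := Subtype.ext <| (ad_i_γ G (Subtype.val y) x).trans
    (ad_map (hker (toHom G.δ)) y x).symm

end Kernel

variable (K) in
/-- The functor sending an internal groupoid to the Hopf crossed module `γ ∘ hker δ`. -/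
noncomputable def kernelXModFunctor : InternalGroupoid (CocommHopf.{u, v} K) ⥤ HXMod.{u, v} K :=
  ObjectProperty.lift _ (InternalGroupoid.forget ⋙ kernelFunctor K) kernelObj_isCrossed

section Unit

variable (G : InternalGroupoid (CocommHopf.{u, v} K))

/-- The comparison `HKer δ ⋊ A₀ → A₁`, `k ⊗ b ↦ k i(b)`, as an isomorphism. -/
noncomputable def kernelSmashIso : (smashObj ((kernelXModFunctor K).obj G)).A₁ ≅ G.A₁ :=
  isoOfBialgEquiv (X := (smashObj ((kernelXModFunctor K).obj G)).A₁)
    (kerSmashEquiv (toHom G.δ) (toHom G.i) fun b => congr(toHom $(G.i_δ) b))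

theorem kernelSmashIso_hom_inl (x : HKer (toHom G.δ)) :
    toHom (kernelSmashIso G).hom (smashInlHom (kerAct_isModuleHopf (toHom G.δ) (toHom G.i)) x) =
      (x : G.A₁.obj) :=
  smashDesc_inl _ _ _ (fun b k => coe_kerAct (toHom G.δ) (toHom G.i) b k) x

theorem i_kernelSmashIso_hom : (smashObj ((kernelXModFunctor K).obj G)).i ≫
    (kernelSmashIso G).hom = G.i :=
  cocommHopf_ext fun b =>
    smashDesc_inr _ _ _ (fun b k => coe_kerAct (toHom G.δ) (toHom G.i) b k) b

/-- The comparison as a morphism of reflexive graphs. -/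
noncomputable def kernelSmashGraphHom :
    smashObj ((kernelXModFunctor K).obj G) ⟶ G.toReflexiveGraph where
  f₁ := (kernelSmashIso G).hom
  f₀ := 𝟙 G.A₀
  comm_δ := by
    apply smashObj_hom_ext
    · intro x
      refine congrArg (toHom G.δ) (kernelSmashIso_hom_inl G x) |>.trans ?_
      exact (apply_of_mem_HKer _ x.2).trans (smashDom_smashInlHom _ x).symm
    · refine ((reassoc_of% i_kernelSmashIso_hom G) _).trans (G.i_δ.trans ?_)
      exact (smashObj ((kernelXModFunctor K).obj G)).i_δ.symm.trans
        (congrArg (_ ≫ ·) (Category.comp_id _).symm)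
  comm_γ := by
    apply smashObj_hom_ext
    · intro x
      refine congrArg (toHom G.γ) (kernelSmashIso_hom_inl G x) |>.trans ?_
      exact (smashCod_smashInlHom _ x).symm
    · refine ((reassoc_of% i_kernelSmashIso_hom G) _).trans (G.i_γ.trans ?_)
      exact (smashObj ((kernelXModFunctor K).obj G)).i_γ.symm.trans
        (congrArg (_ ≫ ·) (Category.comp_id _).symm)
  comm_i := (Category.id_comp _).trans (i_kernelSmashIso_hom G).symm

/-- The comparison as an isomorphism of internal groupoids. -/
noncomputable def kernelSmashGroupoidIso :
    smashGroupoid ((kernelXModFunctor K).obj G) ≅ G :=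
  haveI : IsIso (smashGroupoidHom (kernelSmashGraphHom G)).f₁ :=
    inferInstanceAs (IsIso (kernelSmashIso G).hom)
  haveI : IsIso (smashGroupoidHom (kernelSmashGraphHom G)).f₀ :=
    inferInstanceAs (IsIso (𝟙 G.A₀))
  InternalGroupoid.isoOfIsIso (smashGroupoidHom (kernelSmashGraphHom G))

end Unit

/-- For a Hopf crossed module `d : X → B`, the inclusion `x ↦ x ⊗ 1` is an isomorphism from `X` to
the Hopf kernel of `p₂ : X ⋊ B → B`. -/
noncomputable def smashKernelIso (M : HXMod.{u, v} K) :
    M.obj.X ≅ (kernelObj (smashObj M)).X :=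
  isoOfBialgEquiv (Y := (kernelObj (smashObj M)).X) (smashKerEquiv M.obj.isModuleHopf)

/-- The inclusion `x ↦ x ⊗ 1`, as a morphism of module Hopf maps over `B`. -/
noncomputable def smashKernelHom (M : HXMod.{u, v} K) : M.obj ⟶ kernelObj (smashObj M) where
  α := (smashKernelIso M).hom
  β := 𝟙 M.obj.B
  comm_d := cocommHopf_ext fun x => smashCod_smashInlHom M x
  map_act b x := Subtype.ext (ad_smashUnit_smashInlHom M.obj.isModuleHopf b x).symm

/-- The isomorphism from a Hopf crossed module to the kernel of its smash product groupoid. -/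
noncomputable def smashKernelXModIso (M : HXMod.{u, v} K) :
    M ≅ (kernelXModFunctor K).obj (smashGroupoid M) :=
  haveI : IsIso (smashKernelHom M).α := inferInstanceAs (IsIso (smashKernelIso M).hom)
  haveI : IsIso (smashKernelHom M).β := inferInstanceAs (IsIso (𝟙 M.obj.B))
  ObjectProperty.isoMk _
    (show M.obj ≅ kernelObj (smashObj M) from ModuleHopfMap.isoOfIsIso (smashKernelHom M))

variable (K) in
/-- The equivalence between internal groupoids in cocommutative Hopf algebras and Hopf crossed
modules. -/
noncomputable def groupoidEquivXMod :
    InternalGroupoid (CocommHopf.{u, v} K) ≌ HXMod.{u, v} K :=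
  CategoryTheory.Equivalence.mk (kernelXModFunctor K) (smashGroupoidFunctor K)
    (NatIso.ofComponents (F := kernelXModFunctor K ⋙ smashGroupoidFunctor K)
      (G := 𝟭 (InternalGroupoid (CocommHopf.{u, v} K))) kernelSmashGroupoidIso
      fun {G H} f => InternalGroupoid.Hom.ext
        (cocommHopf_ext <| smash_ext ((kernelXModFunctor K).obj G).obj.isModuleHopf fun x b => by
          change toHom f.f₁ (Subtype.val x : G.A₁.obj) * toHom H.i (toHom f.f₀ b) =
            toHom f.f₁ ((Subtype.val x : G.A₁.obj) * toHom G.i b)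
          have e : toHom H.i (toHom f.f₀ b) = toHom f.f₁ (toHom G.i b) :=
            congr(toHom $(f.comm_i) b)
          rw [map_mul, e])
        ((Category.comp_id _).trans (Category.id_comp _).symm)).symm
    (NatIso.ofComponents (F := 𝟭 (HXMod.{u, v} K))
      (G := smashGroupoidFunctor K ⋙ kernelXModFunctor K) smashKernelXModIso
      fun {M N} f => ObjectProperty.hom_ext _ (ModuleHopfMap.Hom.ext
        (cocommHopf_ext fun x => Subtype.ext <| by
          change (toHom f.hom.α x ⊗ₜ[K] (1 : N.obj.B.obj) : N.obj.X.obj ⊗[K] N.obj.B.obj) =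
            toHom f.hom.α x ⊗ₜ[K] toHom f.hom.β 1
          rw [map_one])
        ((Category.comp_id _).trans (Category.id_comp _).symm))).symm

/-- `smashComp` multiplies the `X`-component of the first arrow with the second arrow. -/
theorem smashComp_eq (M : HXMod.{u, v} K) :
    smashComp M = LinearMap.mul' K (smashObj M).A₁.obj ∘ₗ
      TensorProduct.map (smashKerPart M) LinearMap.id := by
  refine TensorProduct.ext' fun u v => ?_
  let h := M.obj.isModuleHopf
  let F : M.obj.X.obj ⊗[K] M.obj.B.obj →ₗ[K] M.obj.X.obj := (smashFst h).toLinearMap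
  let S : M.obj.X.obj ⊗[K] M.obj.B.obj →ₗ[K] M.obj.X.obj ⊗[K] M.obj.B.obj →ₗ[K]
    M.obj.X.obj ⊗[K] M.obj.B.obj := TensorProduct.curry (smashComp M)
  have key : ∀ u v : M.obj.X.obj ⊗[K] M.obj.B.obj, S u v =
      smashMul M.obj.act (F u ⊗ₜ 1) v := by
    intro u v
    rw [smashMul_tmul, twist_one h]
    induction u with
    | zero => simp
    | add x y hx hy => simp only [map_add, LinearMap.add_apply, hx, hy]
    | tmul x b =>
    induction v with
    | zero => simp
    | add x y hx hy => simp only [map_add, hx, hy]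
    | tmul x' b' =>
      change (x * x') ⊗ₜ[K] (counit (R := K) b • b') = ((counit (R := K) b • x) * x') ⊗ₜ[K] b'
      rw [smul_mul_assoc, TensorProduct.smul_tmul]
  exact key u v

theorem smashPairsComp_apply (M : HXMod.{u, v} K) (t : (smashPairs M).obj) :
    toHom (smashPairsComp M) t = smashComp M (TensorProduct.map
      (toHom (smashPairsFst M)).toLinearMap (toHom (smashPairsSnd M)).toLinearMap
      (comul (R := K) t)) := by
  rw [smashComp_eq, LinearMap.comp_apply, ← LinearMap.comp_apply (TensorProduct.map _ _),
    ← TensorProduct.map_comp]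
  exact congr($(smashPairsComp_eq M) t)

end Equivalence

end HopfXMod

theorem mainTheorem9 (K : Type u) [Field K] :
    ∃ E : InternalGroupoid (CocommHopf.{u, v} K) ≌ HXMod.{u, v} K,
      Nonempty (E.functor ⋙ HXMod.forget K ≅ InternalGroupoid.forget ⋙ kernelFunctor K) ∧
      ∃ e : E.inverse ⋙ InternalGroupoid.forget ≅ smashFunctor K,
        ∀ (M : HXMod.{u, v} K) (t : (E.inverse.obj M).P.obj),
          toHom (e.hom.app M).f₁ (toHom (E.inverse.obj M).m t) =
            smashComp M (TensorProduct.map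
              (toHom ((E.inverse.obj M).p₁ ≫ (e.hom.app M).f₁)).toLinearMap
              (toHom ((E.inverse.obj M).p₂ ≫ (e.hom.app M).f₁)).toLinearMap
              (comul (R := K) t)) :=
  ⟨groupoidEquivXMod K, ⟨Iso.refl _⟩, NatIso.ofComponents fun M => Iso.refl (smashObj M),
    smashPairsComp_apply⟩
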